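/- Work over $\operatorname{Spec}\mathbb{C}$. Let $H$ be a finite abelian group and let $\mathcal{B}H$ be its classifying stack, whose objects over a $\mathbb{C}$-scheme $T$ are the $H$-torsors (principal $H$-bundles, for the étale topology) over $T$. Let $\mathfrak{X}$ and $\mathfrak{Y}$ be Deligne–Mumford stacks over $\mathbb{C}$, and let $\mathfrak{X}\to\mathcal{B}H$ and $\mathfrak{Y}\to\mathcal{B}H$ be morphisms. Then the canonical morphism $$\mathfrak{X}\times_{\mathcal{B}H}\mathfrak{Y}\longrightarrow\mathfrak{X}\times\mathfrak{Y}$$ is surjective, finite, and étale of degree $|H|$; that is, for every $\mathbb{C}$-scheme $T$ and every morphism $T\to\mathfrak{X}\times\mathfrak{Y}$, the base change $T\times_{\mathfrak{X}\times\mathfrak{Y}}(\mathfrak{X}\times_{\mathcal{B}H}\mathfrak{Y})$ is a scheme which is surjective, finite and étale over $T$, of constant degree $|H|$. -/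

import Mathlib

open CategoryTheory CategoryTheory.Functor CategoryTheory.Limits AlgebraicGeometry

universe v₁ v₂ v₃ v₄ u₁ u₂ u₃ u₄ u w

namespace StackTheory

/-! ### Categories over a base category: products, diagonals, 2-fibre products -/

section Based

variable {𝒮 : Type u₁} [Category.{v₁} 𝒮]

/-- The category over `𝒮` represented by an object `T`: the slice category `𝒮/T`. -/
abbrev rep (T : 𝒮) : BasedCategory.{v₁, max u₁ v₁} 𝒮 where
  obj := Over T
  p := Over.forget T

/-- The morphism of represented categories induced by a morphism `V ⟶ T`. -/
def repMap {V T : 𝒮} (v : V ⟶ T) : BasedFunctor (rep V) (rep T) where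
  toFunctor := Over.map v
  w := rfl

variable (𝒳 : BasedCategory.{v₂, u₂} 𝒮) (𝒴 : BasedCategory.{v₃, u₃} 𝒮)

/-- Objects of the product of two categories over `𝒮`: pairs of objects over the same `base`. -/
structure ProdObj where
  base : 𝒮
  fst : 𝒳.p.Fiber base
  snd : 𝒴.p.Fiber base

variable {𝒳 𝒴} in
/-- Morphisms of the product: pairs of morphisms over the same morphism of the base. -/
@[ext]
structure ProdHom (a b : ProdObj 𝒳 𝒴) where
  base : a.base ⟶ b.base
  fst : a.fst.1 ⟶ b.fst.1
  snd : a.snd.1 ⟶ b.snd.1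
  fst_lift : 𝒳.p.IsHomLift base fst
  snd_lift : 𝒴.p.IsHomLift base snd

instance : Category (ProdObj 𝒳 𝒴) where
  Hom a b := ProdHom a b
  id a :=
    { base := 𝟙 _
      fst := 𝟙 _
      snd := 𝟙 _
      fst_lift := IsHomLift.id a.fst.2
      snd_lift := IsHomLift.id a.snd.2 }
  comp f g :=
    { base := f.base ≫ g.base
      fst := f.fst ≫ g.fst
      snd := f.snd ≫ g.snd
      fst_lift := by
        have := f.fst_lift
        have := g.fst_lift
        infer_instance
      snd_lift := by
        have := f.snd_lift
        have := g.snd_lift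
        infer_instance }
  id_comp f := ProdHom.ext (Category.id_comp _) (Category.id_comp _) (Category.id_comp _)
  comp_id f := ProdHom.ext (Category.comp_id _) (Category.comp_id _) (Category.comp_id _)
  assoc f g h := ProdHom.ext (Category.assoc _ _ _) (Category.assoc _ _ _) (Category.assoc _ _ _)

/-- The projection of the product to the base category. -/
def prodProj : ProdObj 𝒳 𝒴 ⥤ 𝒮 where
  obj a := a.base
  map f := ProdHom.base f
  map_id _ := rfl
  map_comp _ _ := rfl

/-- The product `𝒳 × 𝒴` of two categories over `𝒮`. -/
abbrev prod : BasedCategory 𝒮 where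
  obj := ProdObj 𝒳 𝒴
  p := prodProj 𝒳 𝒴

/-- The diagonal morphism `𝒳 ⟶ 𝒳 × 𝒳`. -/
def diagonal : BasedFunctor 𝒳 (prod 𝒳 𝒳) where
  toFunctor :=
    { obj := fun x ↦ (⟨𝒳.p.obj x, ⟨x, rfl⟩, ⟨x, rfl⟩⟩ : ProdObj 𝒳 𝒳)
      map := fun f ↦ ProdHom.mk (𝒳.p.map f) f f inferInstance inferInstance
      map_id := fun x ↦ ProdHom.ext (𝒳.p.map_id x) rfl rfl
      map_comp := fun f g ↦ ProdHom.ext (𝒳.p.map_comp f g) rfl rfl }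
  w := rfl

variable {𝒳 𝒴} {𝒵 : BasedCategory.{v₄, u₄} 𝒮}

/-- Objects of the 2-fibre product `𝒳 ×_𝒵 𝒴`: an object `x` of `𝒳` and an object `y` of `𝒴` over
the same `base`, with an isomorphism `F x ≅ G y` in the fibre of `𝒵` over `base`. -/
structure FiberProdObj (F : BasedFunctor 𝒳 𝒵) (G : BasedFunctor 𝒴 𝒵) where
  base : 𝒮
  fst : 𝒳.p.Fiber base
  snd : 𝒴.p.Fiber base
  iso : F.obj fst.1 ≅ G.obj snd.1
  iso_lift : 𝒵.p.IsHomLift (𝟙 base) iso.hom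

/-- Morphisms of the 2-fibre product: pairs of morphisms over the same morphism of the base,
compatible with the given isomorphisms. -/
@[ext]
structure FiberProdHom {F : BasedFunctor 𝒳 𝒵} {G : BasedFunctor 𝒴 𝒵}
    (a b : FiberProdObj F G) where
  base : a.base ⟶ b.base
  fst : a.fst.1 ⟶ b.fst.1
  snd : a.snd.1 ⟶ b.snd.1
  fst_lift : 𝒳.p.IsHomLift base fst
  snd_lift : 𝒴.p.IsHomLift base snd
  comm : F.map fst ≫ b.iso.hom = a.iso.hom ≫ G.map snd

instance (F : BasedFunctor 𝒳 𝒵) (G : BasedFunctor 𝒴 𝒵) : Category (FiberProdObj F G) where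
  Hom a b := FiberProdHom a b
  id a :=
    { base := 𝟙 _
      fst := 𝟙 _
      snd := 𝟙 _
      fst_lift := IsHomLift.id a.fst.2
      snd_lift := IsHomLift.id a.snd.2
      comm := by simp }
  comp f g :=
    { base := f.base ≫ g.base
      fst := f.fst ≫ g.fst
      snd := f.snd ≫ g.snd
      fst_lift := by
        have := f.fst_lift
        have := g.fst_lift
        infer_instance
      snd_lift := by
        have := f.snd_lift
        have := g.snd_lift
        infer_instance
      comm := by
        rw [Functor.map_comp, Category.assoc, g.comm, ← Category.assoc, f.comm, Category.assoc,
          Functor.map_comp] }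
  id_comp f := FiberProdHom.ext (Category.id_comp _) (Category.id_comp _) (Category.id_comp _)
  comp_id f := FiberProdHom.ext (Category.comp_id _) (Category.comp_id _) (Category.comp_id _)
  assoc f g h :=
    FiberProdHom.ext (Category.assoc _ _ _) (Category.assoc _ _ _) (Category.assoc _ _ _)

/-- The projection of the 2-fibre product to the base category. -/
def fiberProdProj (F : BasedFunctor 𝒳 𝒵) (G : BasedFunctor 𝒴 𝒵) : FiberProdObj F G ⥤ 𝒮 where
  obj a := a.base
  map f := FiberProdHom.base f
  map_id _ := rfl
  map_comp _ _ := rfl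

/-- The 2-fibre product `𝒳 ×_𝒵 𝒴` of categories over `𝒮`. -/
abbrev fiberProd (F : BasedFunctor 𝒳 𝒵) (G : BasedFunctor 𝒴 𝒵) : BasedCategory 𝒮 where
  obj := FiberProdObj F G
  p := fiberProdProj F G

/-- The first projection `𝒳 ×_𝒵 𝒴 ⟶ 𝒳`. -/
def fiberProdFst (F : BasedFunctor 𝒳 𝒵) (G : BasedFunctor 𝒴 𝒵) :
    BasedFunctor (fiberProd F G) 𝒳 where
  toFunctor :=
    { obj := fun a : FiberProdObj F G ↦ a.fst.1
      map := fun f ↦ FiberProdHom.fst f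
      map_id := fun _ ↦ rfl
      map_comp := fun _ _ ↦ rfl }
  w := by
    refine CategoryTheory.Functor.ext (fun a : FiberProdObj F G ↦ a.fst.2) (fun a b f ↦ ?_)
    have := FiberProdHom.fst_lift f
    exact IsHomLift.fac' 𝒳.p (FiberProdHom.base f) (FiberProdHom.fst f)

/-- The canonical morphism `𝒳 ×_𝒵 𝒴 ⟶ 𝒳 × 𝒴`, forgetting the isomorphism. -/
def fiberProdToProd (F : BasedFunctor 𝒳 𝒵) (G : BasedFunctor 𝒴 𝒵) :
    BasedFunctor (fiberProd F G) (prod 𝒳 𝒴) where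
  toFunctor :=
    { obj := fun a : FiberProdObj F G ↦ (⟨a.base, a.fst, a.snd⟩ : ProdObj 𝒳 𝒴)
      map := fun f ↦ ProdHom.mk (FiberProdHom.base f) (FiberProdHom.fst f) (FiberProdHom.snd f)
        (FiberProdHom.fst_lift f) (FiberProdHom.snd_lift f)
      map_id := fun _ ↦ rfl
      map_comp := fun _ _ ↦ rfl }
  w := rfl

/-! ### Stacks in groupoids -/

/-- A category fibred in groupoids: every morphism in a fibre is an isomorphism. -/
structure IsFiberedInGroupoids (𝒳 : BasedCategory.{v₂, u₂} 𝒮) : Prop where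
  isFibered : 𝒳.p.IsFibered
  isIso (T : 𝒮) (x y : 𝒳.p.Fiber T) (φ : x ⟶ y) : IsIso φ

/-- A sieve `R` on `T`, seen as a full subcategory of `𝒮/T`, as a category over `𝒮`. -/
abbrev sieveBased {T : 𝒮} (R : Sieve T) : BasedCategory.{v₁, max u₁ v₁} 𝒮 where
  obj := ObjectProperty.FullSubcategory (fun f : Over T ↦ R f.hom)
  p := ObjectProperty.ι (fun f : Over T ↦ R f.hom) ⋙ Over.forget T

/-- The inclusion of a sieve on `T` in `𝒮/T`. -/
def sieveIncl {T : 𝒮} (R : Sieve T) : BasedFunctor (sieveBased R) (rep T) where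
  toFunctor := ObjectProperty.ι (fun f : Over T ↦ R f.hom)
  w := rfl

/-- Restriction of morphisms `𝒮/T ⟶ 𝒳` to a sieve `R` on `T`; the source is equivalent to the
fibre of `𝒳` over `T` and the target is the category of descent data along `R`. -/
def restrictToSieve (𝒳 : BasedCategory.{v₂, u₂} 𝒮) {T : 𝒮} (R : Sieve T) :
    BasedFunctor (rep T) 𝒳 ⥤ BasedFunctor (sieveBased R) 𝒳 where
  obj F := (sieveIncl R).comp F
  map α := BasedCategory.whiskerLeft (sieveIncl R) α
  map_id _ := rfl
  map_comp _ _ := rfl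

/-- A stack in groupoids for the topology `J`: morphisms and objects descend uniquely along
every covering sieve. -/
structure IsStackInGroupoids (J : GrothendieckTopology 𝒮) (𝒳 : BasedCategory.{v₂, u₂} 𝒮) :
    Prop where
  fibered : IsFiberedInGroupoids 𝒳
  descent (T : 𝒮) (R : Sieve T) (hR : R ∈ J T) : (restrictToSieve 𝒳 R).IsEquivalence

end Based

/-! ### Representable morphisms, algebraic spaces, Deligne–Mumford stacks over a scheme -/

section Stacks

variable {S : Scheme.{u}}

/-- A morphism `F : 𝒵 ⟶ 𝒲` of categories over `Sch/S` is representable by schemes with property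
`P`: for every `S`-scheme `T` and every `T ⟶ 𝒲`, the 2-fibre product `T ×_𝒲 𝒵` is equivalent to
a scheme `V`, and the projection `V ⟶ T` has `P`. -/
def RepresentableWith {𝒵 : BasedCategory.{v₂, u₂} (Over S)} {𝒲 : BasedCategory.{v₃, u₃} (Over S)}
    (P : MorphismProperty Scheme.{u}) (F : BasedFunctor 𝒵 𝒲) : Prop :=
  ∀ (T : Over S) (t : BasedFunctor (rep T) 𝒲),
    ∃ (V : Over S) (v : V ⟶ T) (E : BasedFunctor (rep V) (fiberProd t F)),
      E.toFunctor.IsEquivalence ∧ E.comp (fiberProdFst t F) = repMap v ∧ P v.left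

/-- Surjective morphisms (representable by schemes). -/
def IsSurjectiveMor {𝒵 : BasedCategory.{v₂, u₂} (Over S)} {𝒲 : BasedCategory.{v₃, u₃} (Over S)}
    (F : BasedFunctor 𝒵 𝒲) : Prop :=
  RepresentableWith (fun _ _ v ↦ Surjective v) F

/-- Finite morphisms. -/
def IsFiniteMor {𝒵 : BasedCategory.{v₂, u₂} (Over S)} {𝒲 : BasedCategory.{v₃, u₃} (Over S)}
    (F : BasedFunctor 𝒵 𝒲) : Prop :=
  RepresentableWith (fun _ _ v ↦ IsFinite v) F

/-- Étale morphisms (representable by schemes). -/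
def IsEtaleMor {𝒵 : BasedCategory.{v₂, u₂} (Over S)} {𝒲 : BasedCategory.{v₃, u₃} (Over S)}
    (F : BasedFunctor 𝒵 𝒲) : Prop :=
  RepresentableWith (fun _ _ v ↦ Etale v) F

/-- Finite flat morphisms of constant degree `n`: after base change to any scheme, the direct image
of the structure sheaf has rank `n` at every point. -/
def HasDegree {𝒵 : BasedCategory.{v₂, u₂} (Over S)} {𝒲 : BasedCategory.{v₃, u₃} (Over S)}
    (F : BasedFunctor 𝒵 𝒲) (n : ℕ) : Prop :=
  RepresentableWith
    (fun _ T v ↦ IsFinite v ∧ Flat v ∧ ∀ t : T, Scheme.Hom.finrank v t = n) F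

/-- The big étale topology on `S`-schemes. -/
abbrev etaleTop (S : Scheme.{u}) : GrothendieckTopology (Over S) :=
  Scheme.etaleTopology.over S

/-- Algebraic spaces over `S`, as categories over `Sch/S`: stacks whose fibres have no nontrivial
automorphisms, whose diagonal is representable by schemes, and which admit an étale surjective
morphism from a scheme. -/
structure IsAlgebraicSpace (𝒳 : BasedCategory.{v₂, u₂} (Over S)) : Prop where
  stack : IsStackInGroupoids (etaleTop S) 𝒳
  faithful : 𝒳.p.Faithful
  diag : RepresentableWith ⊤ (diagonal 𝒳)
  atlas : ∃ (U : Over S) (a : BasedFunctor (rep U) 𝒳),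
    RepresentableWith (fun _ _ v ↦ Etale v ∧ Surjective v) a

/-- A morphism is representable by algebraic spaces. -/
def RepresentableByAlgebraicSpaces
    {𝒵 : BasedCategory.{v₂, u₂} (Over S)} {𝒲 : BasedCategory.{v₃, u₃} (Over S)}
    (F : BasedFunctor 𝒵 𝒲) : Prop :=
  ∀ (T : Over S) (t : BasedFunctor (rep T) 𝒲), IsAlgebraicSpace (fiberProd t F)

/-- A morphism is representable by algebraic spaces, étale and surjective: every
base change `T ×_𝒲 𝒵` to a scheme `T` is an algebraic space, with an étale surjective morphism
from a scheme `V` such that the composite `V ⟶ T` is étale and surjective. -/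
def IsEtaleSurjective
    {𝒵 : BasedCategory.{v₂, u₂} (Over S)} {𝒲 : BasedCategory.{v₃, u₃} (Over S)}
    (F : BasedFunctor 𝒵 𝒲) : Prop :=
  RepresentableByAlgebraicSpaces F ∧
  ∀ (T : Over S) (t : BasedFunctor (rep T) 𝒲),
    ∃ (V : Over S) (v : V ⟶ T) (a : BasedFunctor (rep V) (fiberProd t F)),
      RepresentableWith (fun _ _ v ↦ Etale v ∧ Surjective v) a ∧
        a.comp (fiberProdFst t F) = repMap v ∧ Etale v.left ∧ Surjective v.left

/-- Deligne–Mumford stacks over `S`: stacks in groupoids for the étale topology whose diagonal is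
representable by algebraic spaces and which admit an étale surjective morphism from a scheme. -/
structure IsDeligneMumford (𝒳 : BasedCategory.{v₂, u₂} (Over S)) : Prop where
  stack : IsStackInGroupoids (etaleTop S) 𝒳
  diag : RepresentableByAlgebraicSpaces (diagonal 𝒳)
  atlas : ∃ (U : Over S) (a : BasedFunctor (rep U) 𝒳), IsEtaleSurjective a

/-! ### The classifying stack of a finite group -/

/-- An `H`-torsor over a scheme `T`: a `T`-scheme with an action of `H` over `T` such that
`H × P ⟶ P ×_T P`, `(h, x) ↦ (h x, x)`, is an isomorphism, and which has a section
étale locally on `T`. -/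
structure Torsor (H : Type w) [Group H] [Finite H] (T : Scheme.{u}) where
  total : Scheme.{u}
  proj : total ⟶ T
  act : H → (total ⟶ total)
  act_one : act 1 = 𝟙 total
  act_mul (g h : H) : act (g * h) = act h ≫ act g
  act_proj (h : H) : act h ≫ proj = proj
  isIso_shear : IsIso (Sigma.desc fun h : H ↦
    pullback.lift (f := proj) (g := proj) (act h) (𝟙 total) (by simp [act_proj]))
  exists_section : ∃ (T' : Scheme.{u}) (e : T' ⟶ T) (s : T' ⟶ total),
    Etale e ∧ Surjective e ∧ s ≫ proj = e

/-- Objects of `BH`: `H`-torsors over `S`-schemes. -/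
structure BObj (S : Scheme.{u}) (H : Type w) [Group H] [Finite H] where
  base : Over S
  torsor : Torsor H base.left

/-- Morphisms of `BH`: equivariant cartesian squares. -/
@[ext]
structure BHom {S : Scheme.{u}} {H : Type w} [Group H] [Finite H] (a b : BObj S H) where
  base : a.base ⟶ b.base
  total : a.torsor.total ⟶ b.torsor.total
  equivariant (h : H) : a.torsor.act h ≫ total = total ≫ b.torsor.act h
  isPullback : IsPullback total a.torsor.proj b.torsor.proj base.left

instance (S : Scheme.{u}) (H : Type w) [Group H] [Finite H] : Category (BObj S H) where
  Hom a b := BHom a b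
  id a :=
    { base := 𝟙 _
      total := 𝟙 _
      equivariant := by simp
      isPullback := by
        rw [Over.id_left]
        exact IsPullback.of_horiz_isIso ⟨by simp⟩ }
  comp f g :=
    { base := f.base ≫ g.base
      total := f.total ≫ g.total
      equivariant := fun h ↦ by
        rw [← Category.assoc, f.equivariant, Category.assoc, g.equivariant, Category.assoc]
      isPullback := f.isPullback.paste_horiz g.isPullback }
  id_comp f := BHom.ext (Category.id_comp _) (Category.id_comp _)
  comp_id f := BHom.ext (Category.comp_id _) (Category.comp_id _)
  assoc f g h := BHom.ext (Category.assoc _ _ _) (Category.assoc _ _ _)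

/-- The projection of `BH` to the category of `S`-schemes. -/
def bProj (S : Scheme.{u}) (H : Type w) [Group H] [Finite H] : BObj S H ⥤ Over S where
  obj a := a.base
  map f := BHom.base f
  map_id _ := rfl
  map_comp _ _ := rfl

/-- The classifying stack `BH` over `S` of a finite group `H`. -/
abbrev classifyingStack (S : Scheme.{u}) (H : Type w) [Group H] [Finite H] :
    BasedCategory.{u, max (u + 1) w} (Over S) where
  obj := BObj S H
  p := bProj S H

end Stacks

end StackTheory

/-! ### Étale descent of finite étale morphisms. -/

namespace AlgebraicGeometry

/-! A morphism from `T` to `𝒳 × 𝒴` yields, through `F` and `G`, two torsors `P` and `Q` over `T`,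
and lifting it to the 2-fibre product over `BH` means choosing an isomorphism from `P` to `Q`. The
base change is therefore the scheme of isomorphisms, realised as the quotient of `P ×_T Q` by the
diagonal action: the orbit of a pair `(x, y)` stands for the equivariant map sending `x` to `y`.
Pulled back along `P ⟶ T`, this quotient becomes `P ×_T Q ⟶ P`, a base change of `Q ⟶ T`, so it
inherits by descent the properties of a torsor.

Three ingredients carry the argument. A torsor is finite étale of degree `|H|`
(`isFinite_and_etale_proj`, `finrank_proj`), since the shear map turns its pullback to itself into a
disjoint union of `|H|` copies. The quotient is glued from rings of invariants over affine opens of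
`T`, and Galois descent (`Algebra.isPushout_of_invariants`) shows that its base change to `P` is the
original scheme (`isPullback_toQuotient`). Finally, invariant morphisms descend along torsors
(`existsUnique_desc`), which matches points of the quotient with isomorphisms of torsors
(`exists_isomRepresentation`) and gives the equivalence with the 2-fibre product
(`isEquivalence_toFiberProd`). -/

lemma isSeparated_of_universallyClosed_diagonal {X Y : Scheme.{u}} (f : X ⟶ Y)
    [UniversallyClosed (pullback.diagonal f)] : IsSeparated f :=
  ⟨IsClosedImmersion.iff_isPreimmersion.mpr
    ⟨inferInstance, (pullback.diagonal f).isClosedMap.isClosed_range⟩⟩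

lemma HasRingHomProperty.isZariskiLocalAtTarget' (P : MorphismProperty Scheme.{u})
    (Q : ∀ {R S : Type u} [CommRing R] [CommRing S], (R →+* S) → Prop) [HasRingHomProperty P Q] :
    IsZariskiLocalAtTarget P :=
  inferInstance

lemma HasRingHomProperty.isZariskiLocalAtSource' (P : MorphismProperty Scheme.{u})
    (Q : ∀ {R S : Type u} [CommRing R] [CommRing S], (R →+* S) → Prop) [HasRingHomProperty P Q] :
    IsZariskiLocalAtSource P :=
  inferInstance

lemma HasAffineProperty.isZariskiLocalAtTarget' (P : MorphismProperty Scheme.{u})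
    (Q : AffineTargetMorphismProperty.{u}) [HasAffineProperty P Q] : IsZariskiLocalAtTarget P :=
  inferInstance

lemma isStableUnderBaseChange_inf (P Q : MorphismProperty Scheme.{u})
    (_ : P.IsStableUnderBaseChange) (_ : Q.IsStableUnderBaseChange) :
    (P ⊓ Q).IsStableUnderBaseChange :=
  inferInstance

lemma descendsAlong_fppf (P : MorphismProperty Scheme.{u})
    (_ : P.DescendsAlong (@Surjective ⊓ @Flat ⊓ @QuasiCompact)) (_ : IsZariskiLocalAtTarget P) :
    P.DescendsAlong (@Surjective ⊓ @Flat ⊓ @LocallyOfFinitePresentation) :=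
  inferInstance

lemma locallyQuasiFinite_of_etale {X Y : Scheme.{u}} (f : X ⟶ Y) [Etale f] :
    LocallyQuasiFinite f := by
  rw [HasRingHomProperty.iff_appLE (P := @LocallyQuasiFinite)]
  intro U V e
  have h := HasRingHomProperty.appLE (P := @Etale) (f := f) inferInstance U V e
  algebraize [(f.appLE U V e).hom]
  have : Algebra.Etale Γ(Y, U) Γ(X, V) := h
  exact inferInstanceAs (Algebra.QuasiFinite Γ(Y, U) Γ(X, V))

lemma descendsAlong_diagonal {P Q : MorphismProperty Scheme.{u}} (_ : P.DescendsAlong Q)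
    (_ : P.RespectsIso) (_ : Q.IsStableUnderBaseChange) : P.diagonal.DescendsAlong Q :=
  inferInstance

lemma respectsIso_of_isStableUnderBaseChange {P : MorphismProperty Scheme.{u}}
    (_ : P.IsStableUnderBaseChange) : P.RespectsIso :=
  inferInstance

lemma isStableUnderBaseChange_fppf :
    (@Surjective ⊓ @Flat ⊓ @LocallyOfFinitePresentation :
      MorphismProperty Scheme.{u}).IsStableUnderBaseChange :=
  isStableUnderBaseChange_inf _ _ (isStableUnderBaseChange_inf
    (@Surjective : MorphismProperty Scheme.{u}) @Flat inferInstance inferInstance) inferInstance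

/-- Finite étale morphisms satisfy étale descent. -/
theorem isFinite_and_etale_of_isPullback {X' X T' T : Scheme.{u}} {g : X' ⟶ X} {f' : X' ⟶ T'}
    {f : X ⟶ T} {e : T' ⟶ T} (h : IsPullback f' g e f) [Etale e] [Surjective e]
    [IsFinite f'] [Etale f'] : IsFinite f ∧ Etale f := by
  have he : (@Surjective ⊓ @Flat ⊓ @LocallyOfFinitePresentation : MorphismProperty Scheme.{u}) e :=
    -- Finiteness is recovered as proper plus locally quasi-finite: étaleness and universal
    -- closedness descend, the latter also for the diagonal, which gives separatedness.
    ⟨⟨inferInstance, inferInstance⟩, inferInstance⟩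
  have d1 := descendsAlong_fppf (@Etale : MorphismProperty Scheme.{u}) inferInstance
    (HasRingHomProperty.isZariskiLocalAtTarget' _ RingHom.Etale)
  have d2 := descendsAlong_fppf (@UniversallyClosed : MorphismProperty Scheme.{u}) inferInstance
    inferInstance
  have : Etale f := d1.of_isPullback h he inferInstance
  have : UniversallyClosed f := d2.of_isPullback h he inferInstance
  have d3 := descendsAlong_diagonal d2 (respectsIso_of_isStableUnderBaseChange inferInstance) isStableUnderBaseChange_fppf
  have : UniversallyClosed (pullback.diagonal f) :=
    d3.of_isPullback h he (show UniversallyClosed (pullback.diagonal f') by infer_instance)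
  have := isSeparated_of_universallyClosed_diagonal f
  have := locallyQuasiFinite_of_etale f
  have : IsProper f := ⟨⟩
  exact ⟨.of_isProper_of_locallyQuasiFinite f, inferInstance⟩

lemma isFinite_pullback_snd_of_isPullback {X Y Z W : Scheme.{u}} {p : W ⟶ X} {q : W ⟶ Y}
    {f : X ⟶ Z} {g : Y ⟶ Z} (h : IsPullback p q f g) (_ : IsFinite q) :
    IsFinite (pullback.snd f g) := by
  rw [← h.isoPullback_inv_snd]
  infer_instance

/-! ### Finite disjoint unions of copies of a scheme. -/

section Codiagonal

variable (ι : Type w) [Finite ι]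

/-- The codiagonal `∐_ι X ⟶ X`. -/
noncomputable abbrev codiagonal (X : Scheme.{u}) : (∐ fun _ : ι ↦ X) ⟶ X :=
  Limits.Sigma.desc fun _ ↦ 𝟙 X

/-- Finite coproducts of schemes are universal; this lets finiteness and rank be tested on affine
schemes. -/
lemma isPullback_codiagonal {X Y : Scheme.{u}} (f : Y ⟶ X) :
    IsPullback (codiagonal ι Y) (Limits.Sigma.map fun _ : ι ↦ f) f (codiagonal ι X) := by
  have hX := FinitaryPreExtensive.isUniversal_finiteCoproducts
    (coproductIsCoproduct fun _ : ι ↦ X)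
  have h := hX.isPullback_of_isColimit_left (fun _ ↦ 𝟙 X) (codiagonal ι X) f (fun _ ↦ 𝟙 Y)
    (fun _ ↦ f) (fun _ ↦ IsPullback.of_horiz_isIso ⟨by simp⟩)
    (coproductIsCoproduct fun _ : ι ↦ Y) (fun i ↦ by simp [codiagonal])
  have e₁ : codiagonal ι Y =
      Cofan.IsColimit.desc (coproductIsCoproduct fun _ : ι ↦ Y) fun _ ↦ 𝟙 Y :=
    Limits.Sigma.hom_ext _ _ fun i ↦ by simp [codiagonal, Cofan.IsColimit.desc, coproductIsCoproduct]
  have e₂ : (Limits.Sigma.map fun _ : ι ↦ f) =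
      Cofan.IsColimit.desc (coproductIsCoproduct fun _ : ι ↦ Y)
        fun i ↦ f ≫ (Limits.Sigma.ι (fun _ : ι ↦ X) i) :=
    Limits.Sigma.hom_ext _ _ fun i ↦ by simp [Cofan.IsColimit.desc, coproductIsCoproduct]
  rw [e₁, e₂]
  exact h

/-- Serves to replace the index type by one in the universe of the schemes, where `codiagonal_spec`
applies. -/
lemma codiagonal_reindex {κ : Type*} [Finite κ] (e : ι ≃ κ) (X : Scheme.{u}) :
    (Sigma.whiskerEquiv e (fun _ ↦ Iso.refl X)).hom ≫ codiagonal κ X = codiagonal ι X := by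
  refine Limits.Sigma.hom_ext _ _ fun i ↦ ?_
  simp [codiagonal]

lemma codiagonal_spec (ι : Type u) [Finite ι] (R : CommRingCat.{u}) :
    codiagonal ι (Spec R) =
      sigmaSpec (fun _ : ι ↦ R) ≫ Spec.map (CommRingCat.ofHom (algebraMap R (ι → R))) := by
  refine Limits.Sigma.hom_ext _ _ fun i ↦ ?_
  simp only [codiagonal, colimit.ι_desc, Cofan.mk_pt, Cofan.mk_ι_app, ι_sigmaSpec_assoc,
    ← Spec.map_comp]
  exact (Spec.map_id R).symm

instance isFinite_spec_pi (ι : Type u) [Finite ι] (R : CommRingCat.{u}) :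
    IsFinite (Spec.map (CommRingCat.ofHom (algebraMap R (ι → R)))) := by
  rw [IsFinite.SpecMap_iff]
  exact RingHom.finite_algebraMap.mpr inferInstance

instance flat_spec_pi (ι : Type u) [Finite ι] (R : CommRingCat.{u}) :
    Flat (Spec.map (CommRingCat.ofHom (algebraMap R (ι → R)))) := by
  rw [Flat.SpecMap_iff]
  exact RingHom.flat_algebraMap_iff.mpr inferInstance

lemma isFinite_codiagonal_spec (ι : Type u) [Finite ι] (R : CommRingCat.{u}) :
    IsFinite (codiagonal ι (Spec R)) := by
  rw [codiagonal_spec]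
  infer_instance

instance isFinite_codiagonal (X : Scheme.{u}) : IsFinite (codiagonal ι X) := by
  obtain ⟨n, ⟨e⟩⟩ := Finite.exists_equiv_fin ι
  rw [← codiagonal_reindex ι (e.trans Equiv.ulift.{u}.symm)]
  refine MorphismProperty.comp_mem @IsFinite _ _ inferInstance ?_
  have := @HasAffineProperty.isZariskiLocalAtTarget' (@IsFinite : MorphismProperty Scheme.{u}) _
    IsFinite.instHasAffinePropertyAndIsAffineFiniteCarrierObjOppositeOpensCarrierCarrierCommRingCatPresheafOpOpensTopHomAppTop
  refine IsZariskiLocalAtTarget.of_openCover (P := @IsFinite) X.affineCover fun i ↦ ?_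
  exact isFinite_pullback_snd_of_isPullback (isPullback_codiagonal _ (X.affineCover.f i)).flip
    (isFinite_codiagonal_spec _ _)

instance etale_codiagonal (X : Scheme.{u}) : Etale (codiagonal ι X) :=
  have := HasRingHomProperty.isZariskiLocalAtSource' (@Etale : MorphismProperty Scheme.{u})
    RingHom.Etale
  IsZariskiLocalAtSource.sigmaDesc (P := @Etale) fun _ ↦ inferInstanceAs (Etale (𝟙 X))

lemma finrank_codiagonal (X : Scheme.{u}) (x : X) :
    (codiagonal ι X).finrank x = Nat.card ι := by
  obtain ⟨n, ⟨e⟩⟩ := Finite.exists_equiv_fin ι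
  obtain ⟨R, f, -, y, rfl⟩ := X.exists_Spec_apply_eq x
  rw [← codiagonal_reindex ι (e.trans Equiv.ulift.{u}.symm), Scheme.Hom.finrank_comp_left_of_isIso,
    ← Scheme.Hom.finrank_of_isPullback _ _ _ _ (isPullback_codiagonal _ f).flip, codiagonal_spec,
    Scheme.Hom.finrank_comp_left_of_isIso]
  refine (Scheme.Hom.finrank_SpecMap_algebraMap R (ULift.{u} (Fin n) → R) y).trans ?_
  have : Nontrivial R := y.nontrivial
  rw [Module.rankAtStalk_eq_finrank_of_free]
  simp [Nat.card_congr e]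
  rfl

end Codiagonal

end AlgebraicGeometry

/-! ### Torsors are finite étale of degree `|H|`. -/

namespace StackTheory

namespace Torsor

variable {H : Type w} [Group H] [Finite H] {T : Scheme.{u}} (P : Torsor H T)

/-- The shear map `∐_H P ⟶ P ×_T P`. -/
noncomputable abbrev shear : (∐ fun _ : H ↦ P.total) ⟶ pullback P.proj P.proj :=
  Limits.Sigma.desc fun h : H ↦
    pullback.lift (f := P.proj) (g := P.proj) (P.act h) (𝟙 P.total) (by simp [P.act_proj])

instance : IsIso P.shear := P.isIso_shear

lemma shear_snd : P.shear ≫ pullback.snd P.proj P.proj = codiagonal H P.total :=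
  Limits.Sigma.hom_ext _ _ fun h ↦ by
    simp [shear, codiagonal, pullback.lift_snd]

lemma inv_shear_codiagonal :
    inv P.shear ≫ codiagonal H P.total = pullback.snd P.proj P.proj := by
  rw [IsIso.inv_comp_eq, shear_snd]

instance : IsFinite (pullback.snd P.proj P.proj) := by
  rw [← inv_shear_codiagonal]; infer_instance

instance : Etale (pullback.snd P.proj P.proj) := by
  rw [← inv_shear_codiagonal]; infer_instance

/-- Pulling the second projection of `P ×_T P` back along a local section `s` gives the base change
of `P` to `T'`. That projection is a codiagonal up to the shear isomorphism, so descent along `T' ⟶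
T` applies. -/
lemma isFinite_and_etale_proj : IsFinite P.proj ∧ Etale P.proj := by
  obtain ⟨T', e, s, _, _, rfl⟩ := P.exists_section
  have h : IsPullback (pullback.fst s (pullback.snd P.proj P.proj))
      (pullback.snd s (pullback.snd P.proj P.proj) ≫ pullback.fst P.proj P.proj)
      (s ≫ P.proj) P.proj :=
    (IsPullback.of_hasPullback s (pullback.snd P.proj P.proj)).paste_vert
      (IsPullback.of_hasPullback P.proj P.proj).flip
  have : IsFinite (pullback.fst s (pullback.snd P.proj P.proj)) := inferInstance
  have : Etale (pullback.fst s (pullback.snd P.proj P.proj)) := inferInstance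
  exact isFinite_and_etale_of_isPullback h

instance : IsFinite P.proj := P.isFinite_and_etale_proj.1

instance : Etale P.proj := P.isFinite_and_etale_proj.2

instance : Surjective P.proj := by
  obtain ⟨T', e, s, _, _, rfl⟩ := P.exists_section
  exact .of_comp s P.proj

/-- The rank is unchanged by base change to `P` itself, where the torsor is a codiagonal. -/
lemma finrank_proj (t : T) : P.proj.finrank t = Nat.card H := by
  obtain ⟨p, rfl⟩ := P.proj.surjective t
  rw [← Scheme.Hom.finrank_pullback_snd, ← inv_shear_codiagonal,
    Scheme.Hom.finrank_comp_left_of_isIso, finrank_codiagonal]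

end Torsor

end StackTheory

/-! ### Galois descent for algebras. -/

section GaloisDescent

open scoped TensorProduct

variable {H A C B D : Type*} [Group H] [Fintype H] [CommRing A] [CommRing C]
  [CommRing B] [CommRing D]

/-- The sum over the group of the translates of an element is invariant. -/
lemma sum_translates_invariant (ρ : H → B →+* B) (hρ : ∀ g h b, ρ (g * h) b = ρ h (ρ g b))
    (h : H) (b : B) : ρ h (∑ g, ρ g b) = ∑ g, ρ g b := by
  simp only [_root_.map_sum, ← hρ]
  exact Fintype.sum_equiv (Equiv.mulRight h) _ _ fun _ ↦ rfl

variable [Algebra A C] [Algebra C B] [Algebra A B] [Algebra A D] [Algebra D B]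
  [IsScalarTower A C B] [IsScalarTower A D B]

/-- **Galois descent for algebras**: if `A` is the ring of invariants of the `H`-Galois extension
`C` and `B` is a `C`-algebra with a compatible action of `H` with ring of invariants `D`,
then `B` is the base change of `D` along `A ⟶ C`. -/
theorem Algebra.isPushout_of_invariants [DecidableEq H] (σ : H → C →+* C) (ρ : H → B →+* B)
    (hσ : ∀ g h c, σ (g * h) c = σ h (σ g c)) (hρ : ∀ g h b, ρ (g * h) b = ρ h (ρ g b))
    (hσ₁ : ∀ c, σ 1 c = c)
    (hρ₁ : ∀ b, ρ 1 b = b) (hσρ : ∀ h c, ρ h (algebraMap C B c) = algebraMap C B (σ h c))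
    (hC : ∀ c, (∀ h, σ h c = c) → ∃ a, algebraMap A C a = c)
    (hD : Function.Injective (algebraMap D B)) (hDρ : ∀ h d, ρ h (algebraMap D B d) = algebraMap D B d)
    (hB : ∀ b, (∀ h, ρ h b = b) → ∃ d, algebraMap D B d = b)
    (s : Finset (C × C)) (hs : ∀ h, ∑ i ∈ s, i.1 * σ h i.2 = if h = 1 then 1 else 0) :
    Algebra.IsPushout A C D B := by
  have hB' (b : B) := hB _ fun h ↦ sum_translates_invariant ρ hρ h b
  choose tr htr using hB'
  have htr_add (b b' : B) : tr (b + b') = tr b + tr b' :=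
    hD (by simp [htr, Finset.sum_add_distrib])
  let f : C ⊗[A] D →ₐ[C] B :=
    Algebra.TensorProduct.lift (Algebra.ofId C B) (IsScalarTower.toAlgHom A D B)
      fun _ _ ↦ Commute.all _ _
  have hf (c : C) (d : D) : f (c ⊗ₜ d) = algebraMap C B c * algebraMap D B d := by
    simp [f, Algebra.ofId_apply]
  -- Expanding the trace and exchanging sums gives `∑ h, (∑ i, x_i * σ h y_i) * ρ h b`, and by `hs`
  -- only `h = 1` survives.
  have key (b : B) : ∑ i ∈ s, algebraMap C B i.1 * algebraMap D B (tr (algebraMap C B i.2 * b)) = b := by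
    simp only [htr, _root_.map_mul, hσρ, Finset.mul_sum]
    rw [Finset.sum_comm]
    simp only [← mul_assoc, ← Finset.sum_mul]
    simp only [← _root_.map_mul, ← _root_.map_sum, hs]
    simp [hρ₁]
  let g : B →+ C ⊗[A] D :=
    { toFun b := ∑ i ∈ s, i.1 ⊗ₜ tr (algebraMap C B i.2 * b)
      map_zero' := by
        have : tr 0 = 0 := by simpa using htr_add 0 0
        simp [this]
      map_add' b b' := by simp [mul_add, htr_add, TensorProduct.tmul_add, Finset.sum_add_distrib] }
  have hfg (b : B) : f (g b) = b := by
    simp only [g, AddMonoidHom.coe_mk, ZeroHom.coe_mk, _root_.map_sum, hf, key]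
  have hgf (z : C ⊗[A] D) : g (f z) = z := by
    induction z with
    | zero => simp
    | add z z' hz hz' => rw [_root_.map_add, _root_.map_add, hz, hz']
    | tmul c d =>
      -- The trace of `y_i * c` lies in `A`, so it moves across the tensor product, leaving the same
      -- expansion as in `key`, now for `c` in `C`.
      have h₁ (i : C × C) := hC _ fun h ↦ sum_translates_invariant σ hσ h (i.2 * c)
      choose a ha using h₁
      have h₂ (i : C × C) : tr (algebraMap C B i.2 * (algebraMap C B c * algebraMap D B d)) =
          a i • d := hD <| by
        rw [htr, Algebra.smul_def, map_mul, ← IsScalarTower.algebraMap_apply A D B,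
          IsScalarTower.algebraMap_apply A C B, ha, ← mul_assoc]
        simp only [_root_.map_mul, hDρ, _root_.map_sum, Finset.sum_mul, hσρ]
      simp only [g, AddMonoidHom.coe_mk, ZeroHom.coe_mk, hf, h₂, ← TensorProduct.smul_tmul,
        ← TensorProduct.sum_tmul]
      congr 1
      simp only [Algebra.smul_def, ha, Finset.sum_mul, _root_.map_mul]
      rw [Finset.sum_comm]
      have (h : H) : ∑ i ∈ s, σ h i.2 * σ h c * i.1 = (∑ i ∈ s, i.1 * σ h i.2) * σ h c := by
        rw [Finset.sum_mul]
        exact Finset.sum_congr rfl fun _ _ ↦ by ring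
      simp [this, hs, hσ₁]
  exact ⟨.of_equiv (LinearEquiv.ofBijective f.toLinearMap
    ⟨Function.LeftInverse.injective hgf, Function.RightInverse.surjective hfg⟩) fun d ↦
      (hf 1 d).trans (by simp)⟩

end GaloisDescent

/-! ### Rings of invariants and localization. -/

section InvariantSubring

variable {H B : Type*} [CommRing B]

/-- The subring of elements fixed by a family of endomorphisms. -/
def invariantSubring (σ : H → B →+* B) : Subring B := ⨅ h, (σ h).eqLocus (RingHom.id B)

lemma mem_invariantSubring {σ : H → B →+* B} {b : B} :
    b ∈ invariantSubring σ ↔ ∀ h, σ h b = b := by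
  simp [invariantSubring, Subring.mem_iInf]

/-- The map induced on fixed subrings. -/
def invariantSubring.map {B' : Type*} [CommRing B'] {σ : H → B →+* B} {σ' : H → B' →+* B'}
    (φ : B →+* B') (hφ : ∀ h b, σ' h (φ b) = φ (σ h b)) :
    invariantSubring σ →+* invariantSubring σ' :=
  φ.restrict _ _ fun b hb ↦ mem_invariantSubring.mpr fun h ↦ by
    rw [hφ, mem_invariantSubring.mp hb]

/-- Taking fixed elements commutes with localization. -/
lemma isLocalization_invariantSubring [Finite H] {B' : Type*} [CommRing B'] {σ : H → B →+* B}
    {σ' : H → B' →+* B'} (φ : B →+* B') (hφ : ∀ h b, σ' h (φ b) = φ (σ h b))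
    (r : invariantSubring σ)
    (hr : letI := φ.toAlgebra; IsLocalization.Away (r : B) B') :
    letI := (invariantSubring.map φ hφ).toAlgebra
    IsLocalization.Away r (invariantSubring σ') := by
  let := φ.toAlgebra
  let := (invariantSubring.map φ hφ).toAlgebra
  have hu : IsUnit (φ r) := IsLocalization.Away.algebraMap_isUnit (S := B') (r : B)
  have hr' (h : H) : σ h r = r := mem_invariantSubring.mp r.2 h
  refine ⟨⟨?_, ?_, ?_⟩⟩
  · rintro ⟨-, n, rfl⟩
    simp only [map_pow]
    refine IsUnit.pow n ?_
    obtain ⟨s, hs⟩ := hu.exists_right_inv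
    -- The inverse is invariant: each of its translates is again inverse to the fixed element `φ r`.
    refine IsUnit.of_mul_eq_one ⟨s, mem_invariantSubring.mpr fun h ↦ ?_⟩ (Subtype.ext hs)
    refine hu.mul_left_cancel ?_
    rw [hs]
    simpa [hφ, hr'] using congr(σ' h $hs)
  · rintro ⟨x, hx⟩
    obtain ⟨n, b, hb⟩ := IsLocalization.Away.surj (S := B') (r : B) x
    change x * φ r ^ n = φ b at hb
    have (h : H) : ∃ m, (r : B) ^ m * σ h b = r ^ m * b := by
      have : φ (σ h b) = φ b := by
        rw [← hφ, ← hb, _root_.map_mul, mem_invariantSubring.mp hx, _root_.map_pow, hφ, hr']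
      obtain ⟨⟨_, m, rfl⟩, hm⟩ := (IsLocalization.eq_iff_exists (.powers (r : B)) B').mp this
      exact ⟨m, hm⟩
    choose m hm using this
    -- As `H` is finite, one exponent works for all group elements, which makes `r ^ M * b`
    -- invariant.
    obtain ⟨M, hM⟩ := (Set.finite_range m).bddAbove
    have hM' (h : H) : (r : B) ^ M * σ h b = r ^ M * b := by
      obtain ⟨k, hk⟩ := Nat.exists_eq_add_of_le (hM ⟨h, rfl⟩)
      rw [hk, pow_add, mul_right_comm, hm]
      ring
    refine ⟨⟨⟨r ^ M * b, mem_invariantSubring.mpr fun h ↦ ?_⟩, ⟨r ^ (M + n), _, rfl⟩⟩,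
      Subtype.ext ?_⟩
    · rw [_root_.map_mul, _root_.map_pow, hr', hM']
    · change x * φ (r ^ (M + n)) = φ (r ^ M * b)
      rw [_root_.map_mul, ← hb, _root_.map_pow, _root_.map_pow]
      ring
  · intro x y hxy
    have : φ x = φ y := congr_arg Subtype.val hxy
    obtain ⟨⟨_, m, rfl⟩, hm⟩ := (IsLocalization.eq_iff_exists (.powers (r : B)) B').mp this
    exact ⟨⟨r ^ m, _, rfl⟩, Subtype.ext hm⟩

end InvariantSubring

/-! ### Quotients by a finite group acting over a base. -/

namespace AlgebraicGeometry

open Scheme AffineZariskiSite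

namespace invariants

variable {H : Type w} {W T : Scheme.{u}} (π : W ⟶ T) (act : H → (W ⟶ W))
  (hact : ∀ h, act h ≫ π = π)

include hact in
lemma preimage_le (U : T.Opens) (h : H) : π ⁻¹ᵁ U ≤ act h ⁻¹ᵁ π ⁻¹ᵁ U := by
  rw [← Scheme.Hom.comp_preimage, hact]

/-- The action on sections over the preimage of an open subset. -/
noncomputable def actHom (U : T.Opens) (h : H) : Γ(W, π ⁻¹ᵁ U) ⟶ Γ(W, π ⁻¹ᵁ U) :=
  (act h).appLE (π ⁻¹ᵁ U) (π ⁻¹ᵁ U) (preimage_le π act hact U h)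

lemma app_actHom (U : T.Opens) (h : H) : π.app U ≫ actHom π act hact U h = π.app U := by
  rw [actHom, Scheme.Hom.app_eq_appLE, Scheme.Hom.appLE_comp_appLE]
  simp only [hact]

lemma map_actHom {U V : T.Opens} (i : V ≤ U) (h : H) :
    W.presheaf.map (homOfLE (π.preimage_mono i)).op ≫ actHom π act hact V h =
      actHom π act hact U h ≫ W.presheaf.map (homOfLE (π.preimage_mono i)).op := by
  rw [actHom, actHom, Scheme.Hom.map_appLE, Scheme.Hom.appLE_map]

/-- The invariant sections. -/
noncomputable abbrev subring (U : T.Opens) : Subring Γ(W, π ⁻¹ᵁ U) :=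
  invariantSubring fun h ↦ (actHom π act hact U h).hom

/-- Restriction of invariant sections. -/
noncomputable def res {U V : T.Opens} (i : V ≤ U) :
    subring π act hact U →+* subring π act hact V :=
  invariantSubring.map (W.presheaf.map (homOfLE (π.preimage_mono i)).op).hom
    fun h b ↦ congr($(map_actHom π act hact i h).hom b)

/-- The presheaf of invariant sections. -/
noncomputable def diagram : T.Opensᵒᵖ ⥤ CommRingCat where
  obj U := .of (subring π act hact U.unop)
  map i := CommRingCat.ofHom (res π act hact i.unop.le)
  map_id U := by
    refine CommRingCat.hom_ext (RingHom.ext fun x ↦ Subtype.ext ?_)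
    exact congr($(W.presheaf.map_id _).hom x.1)
  map_comp {U V X} i j := by
    refine CommRingCat.hom_ext (RingHom.ext fun x ↦ Subtype.ext ?_)
    exact congr($(W.presheaf.map_comp
      (homOfLE (π.preimage_mono i.unop.le)).op (homOfLE (π.preimage_mono j.unop.le)).op).hom x.1)

/-- The map from the sections of the base to the invariant sections. -/
noncomputable def baseToSubring (U : T.Opens) : Γ(T, U) ⟶ .of (subring π act hact U) :=
  CommRingCat.ofHom ((π.app U).hom.codRestrict (subring π act hact U) fun x ↦
    mem_invariantSubring.mpr fun h ↦ congr($(app_actHom π act hact U h).hom x))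

lemma baseToSubring_subtype (U : T.Opens) :
    baseToSubring π act hact U ≫ CommRingCat.ofHom (subring π act hact U).subtype = π.app U :=
  rfl

/-- The structure map of the presheaf of invariant sections. -/
noncomputable def diagramMap : T.presheaf ⟶ diagram π act hact where
  app U := baseToSubring π act hact U.unop
  naturality {U V} i := by ext x; exact Subtype.ext congr($(π.naturality i) x)

lemma isLocalization_preimage_basicOpen [QuasiCompact π] [QuasiSeparated π] {U : T.Opens}
    (hU : IsAffineOpen U) (r : Γ(T, U)) :
    letI := (W.presheaf.map (homOfLE (π.preimage_mono (T.basicOpen_le r))).op).hom.toAlgebra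
    IsLocalization.Away (π.app U r) Γ(W, π ⁻¹ᵁ T.basicOpen r) := by
  have key (V : W.Opens) (hV : V = W.basicOpen (π.app U r)) (hle : V ≤ π ⁻¹ᵁ U) :
      letI := (W.presheaf.map (homOfLE hle).op).hom.toAlgebra
      IsLocalization.Away (π.app U r) Γ(W, V) := by
    subst hV
    exact isLocalization_basicOpen_of_qcqs (π.isCompact_preimage hU.isCompact)
      (π.isQuasiSeparated_preimage hU.isQuasiSeparated) (π.app _ r)
  exact key _ (π.preimage_basicOpen r) _

/-- Compatibility of invariants with localization is exactly the condition under which the spectra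
of invariants glue over the affine opens of `T`. -/
lemma coequifibered_diagramMap [Finite H] [QuasiCompact π] [QuasiSeparated π] :
    ((toOpensFunctor T).op.whiskerLeft (diagramMap π act hact)).Coequifibered :=
  coequifibered_iff_forall_isLocalizationAway.mpr fun U r ↦
    isLocalization_invariantSubring (σ := fun h ↦ (actHom π act hact U.1 h).hom)
      (σ' := fun h ↦ (actHom π act hact (T.basicOpen r) h).hom) (W.presheaf.map (homOfLE (π.preimage_mono (T.basicOpen_le r))).op).hom
      (fun h b ↦ congr($(map_actHom π act hact (T.basicOpen_le r) h).hom b)) _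
      (isLocalization_preimage_basicOpen π U.2 r)

end invariants

section Quotient

variable {H : Type w} {W T : Scheme.{u}} (π : W ⟶ T) (act : H → (W ⟶ W))
  (hact : ∀ h, act h ≫ π = π) [Finite H] [QuasiCompact π] [QuasiSeparated π]

open invariants

/-- The gluing datum for the quotient. -/
noncomputable def quotientGlueData : (directedCover T).RelativeGluingData :=
  relativeGluingData (coequifibered_diagramMap π act hact)

instance : ((quotientGlueData π act hact).functor ⋙ Scheme.forget).IsLocallyDirected :=
  Cover.RelativeGluingData.instIsLocallyDirectedI₀CompFunctorForgetOfIsThin ..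

/-- The quotient by a finite group acting over a base, glued from rings of invariants. -/
noncomputable def quotient : Scheme.{u} := (quotientGlueData π act hact).glued

/-- The chart of the quotient over an affine open subset. -/
noncomputable def quotientι {U : T.Opens} (hU : IsAffineOpen U) :
    Spec (.of (subring π act hact U)) ⟶ quotient π act hact :=
  colimit.ι (quotientGlueData π act hact).functor (⟨U, hU⟩ : T.AffineZariskiSite)

/-- The structure map of the quotient. -/
noncomputable def quotientToBase : quotient π act hact ⟶ T := (quotientGlueData π act hact).toBase

lemma isPullback_quotientι {U : T.Opens} (hU : IsAffineOpen U) :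
    IsPullback (quotientι π act hact hU) (Spec.map (baseToSubring π act hact U))
      (quotientToBase π act hact) hU.fromSpec := by
  have := ((quotientGlueData π act hact).isPullback_natTrans_ι_toBase
    (⟨U, hU⟩ : T.AffineZariskiSite)).flip
  refine IsPullback.of_iso this (Iso.refl _) (Iso.refl _) hU.isoSpec (Iso.refl _) ?_ ?_ ?_ ?_
  · exact (Category.comp_id _).trans (Category.id_comp _).symm
  · refine (Category.assoc _ _ _).trans ?_
    refine (congr_arg _ hU.isoSpec.inv_hom_id).trans ?_
    exact (Category.comp_id _).trans (Category.id_comp _).symm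
  · exact (Category.comp_id _).trans (Category.id_comp _).symm
  · refine (Category.comp_id _).trans ?_
    exact hU.isoSpec_hom_fromSpec.symm

/-- The local quotient maps. -/
noncomputable def toQuotientAux {U : T.Opens} (hU : IsAffineOpen U) :
    (π ⁻¹ᵁ U).toScheme ⟶ quotient π act hact :=
  (π ⁻¹ᵁ U).toSpecΓ ≫ Spec.map (CommRingCat.ofHom (subring π act hact U).subtype) ≫
    quotientι π act hact hU

lemma map_quotientι {U V : T.AffineZariskiSite} (i : U ⟶ V) :
    Spec.map (CommRingCat.ofHom (res π act hact (toOpens_mono i.1.1))) ≫ quotientι π act hact V.2 =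
      quotientι π act hact U.2 :=
  colimit.w (quotientGlueData π act hact).functor i

lemma homOfLE_toQuotientAux {U V : T.AffineZariskiSite} (i : U ⟶ V) :
    W.homOfLE (π.preimage_mono (toOpens_mono i.1.1)) ≫ toQuotientAux π act hact V.2 =
      toQuotientAux π act hact U.2 := by
  unfold toQuotientAux
  rw [← map_quotientι π act hact i, ← Scheme.Opens.toSpecΓ_SpecMap_presheaf_map_assoc,
    ← Spec.map_comp_assoc, ← Spec.map_comp_assoc]
  rfl

omit [QuasiCompact π] [QuasiSeparated π] in
lemma map_pullbackRestrictIsoRestrict {U V : T.Opens} (i : U ≤ V) :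
    pullback.map π U.ι π V.ι (𝟙 _) (T.homOfLE i) (𝟙 _) (by simp) (by simp) ≫
      (pullbackRestrictIsoRestrict π V).hom =
    (pullbackRestrictIsoRestrict π U).hom ≫ W.homOfLE (π.preimage_mono i) := by
  rw [← cancel_mono (Scheme.Opens.ι _)]
  simp only [Category.assoc, pullbackRestrictIsoRestrict_hom_ι, Scheme.homOfLE_ι]
  exact (pullback.lift_fst _ _ _).trans (Category.comp_id _)

lemma toQuotient_compat {U V : T.AffineZariskiSite} (i : U ⟶ V) :
    Cover.trans ((directedCover T).pullback₁ π) i ≫ (pullbackRestrictIsoRestrict π V.1).hom ≫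
      toQuotientAux π act hact V.2 =
    (pullbackRestrictIsoRestrict π U.1).hom ≫ toQuotientAux π act hact U.2 :=
  (Category.assoc _ _ _).symm.trans <|
  (congr_arg (· ≫ toQuotientAux π act hact V.2)
    (map_pullbackRestrictIsoRestrict π (toOpens_mono i.1.1))).trans <|
  (Category.assoc _ _ _).trans <| congr_arg ((pullbackRestrictIsoRestrict π U.1).hom ≫ ·)
    (homOfLE_toQuotientAux π act hact i)

/-- The quotient map. -/
noncomputable def toQuotient : W ⟶ quotient π act hact :=
  Scheme.OpenCover.glueMorphismsOfLocallyDirected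
    ((directedCover T).pullback₁ π)
    (fun U ↦ (pullbackRestrictIsoRestrict π U.1).hom ≫ toQuotientAux π act hact U.2)
    fun i ↦ toQuotient_compat π act hact i

lemma ι_toQuotient {U : T.Opens} (hU : IsAffineOpen U) :
    (π ⁻¹ᵁ U).ι ≫ toQuotient π act hact = toQuotientAux π act hact hU := by
  rw [← cancel_epi (pullbackRestrictIsoRestrict π U).hom, ← Category.assoc,
    pullbackRestrictIsoRestrict_hom_ι]
  exact Scheme.OpenCover.map_glueMorphismsOfLocallyDirected ((directedCover T).pullback₁ π) _
    (fun i ↦ toQuotient_compat π act hact i) (⟨U, hU⟩ : T.AffineZariskiSite)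

omit [QuasiCompact π] [QuasiSeparated π] in
/-- Two morphisms agreeing over all affine open subsets of the base are equal. -/
lemma hom_ext_of_affineOpens {Z : Scheme.{u}} {f g : W ⟶ Z}
    (h : ∀ {U : T.Opens}, IsAffineOpen U → (π ⁻¹ᵁ U).ι ≫ f = (π ⁻¹ᵁ U).ι ≫ g) : f = g :=
  Scheme.Cover.hom_ext (W.openCoverOfIsOpenCover _
    (.comap (iSup_affineOpens_eq_top T) π.base.1)) _ _ fun U ↦ h U.2

lemma toQuotient_toBase : toQuotient π act hact ≫ quotientToBase π act hact = π := by
  refine hom_ext_of_affineOpens π fun {U} hU ↦ ?_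
  rw [← Category.assoc, ι_toQuotient π act hact hU, toQuotientAux, Category.assoc, Category.assoc,
    (isPullback_quotientι π act hact hU).w, ← Spec.map_comp_assoc,
    baseToSubring_subtype, Scheme.Opens.toSpecΓ_naturality_assoc, IsAffineOpen.toSpecΓ_fromSpec,
    morphismRestrict_ι]

/-- Checked over affine opens of `T`, where the quotient map comes from the inclusion of sections
fixed by the action. -/
lemma act_toQuotient (h : H) : act h ≫ toQuotient π act hact = toQuotient π act hact := by
  refine hom_ext_of_affineOpens π fun {U} hU ↦ ?_
  rw [← Category.assoc, ← Scheme.Hom.resLE_comp_ι (act h) (preimage_le π act hact U h),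
    Category.assoc, ι_toQuotient π act hact hU, toQuotientAux, ← Scheme.Opens.toSpecΓ_SpecMap_appLE_assoc,
    ← Spec.map_comp_assoc]
  congr 3
  refine CommRingCat.hom_ext (RingHom.ext fun x ↦ ?_)
  exact mem_invariantSubring.mp x.2 h

end Quotient

end AlgebraicGeometry

/-- Transported from the tensor product, whose elements are finite sums of pure tensors. -/
lemma CommRingCat.exists_finset_of_isPushout {R A B X : CommRingCat.{u}} {f : R ⟶ A} {g : R ⟶ B}
    {inl : A ⟶ X} {inr : B ⟶ X} (h : IsPushout f g inl inr) (x : X) :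
    ∃ s : Finset (A × B), x = ∑ i ∈ s, inl.hom i.1 * inr.hom i.2 := by
  algebraize [f.hom, g.hom]
  let h' : IsPushout f g _ _ := CommRingCat.isPushout_tensorProduct R A B
  obtain ⟨s, hs⟩ := TensorProduct.exists_finset ((h'.isoIsPushout _ _ h).inv.hom x)
  refine ⟨s, ?_⟩
  have h₁ := congr((h'.isoIsPushout _ _ h).hom.hom $hs)
  rw [_root_.map_sum] at h₁
  have h₂ : (h'.isoIsPushout _ _ h).hom.hom ((h'.isoIsPushout _ _ h).inv.hom x) = x :=
    congr($((h'.isoIsPushout _ _ h).inv_hom_id).hom x)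
  rw [← h₂, h₁]
  refine Finset.sum_congr rfl fun i _ ↦ ?_
  rw [← mul_one i.1, ← one_mul i.2, ← Algebra.TensorProduct.tmul_mul_tmul, _root_.map_mul, mul_one,
    one_mul]
  congr 1
  · exact congr($(IsPushout.inl_isoIsPushout_hom _ _ h' h).hom i.1)
  · exact congr($(IsPushout.inr_isoIsPushout_hom _ _ h' h).hom i.2)

/-! ### Descent of invariant morphisms and the Galois property of torsors. -/

namespace StackTheory

namespace Torsor

open AffineSpace

variable {H : Type w} [Group H] [Finite H] {T : Scheme.{u}} (P : Torsor H T)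

/-- The components of the shear map. -/
noncomputable abbrev shearι (h : H) : P.total ⟶ pullback P.proj P.proj :=
  pullback.lift (f := P.proj) (g := P.proj) (P.act h) (𝟙 P.total) (by simp [P.act_proj])

lemma shearι_inv_shear (h : H) :
    P.shearι h ≫ inv P.shear = Limits.Sigma.ι (fun _ : H ↦ P.total) h := by
  rw [IsIso.comp_inv_eq]
  simp [shear]

/-- Points of a torsor with the same projection are locally in the same orbit; hence
morphisms out of the source are determined by their restrictions to the loci where the points
differ by a given group element. -/
lemma hom_ext_of_orbit {Z X : Scheme.{u}} {g₁ g₂ : Z ⟶ P.total} (hg : g₁ ≫ P.proj = g₂ ≫ P.proj)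
    {f₁ f₂ : Z ⟶ X}
    (hf : ∀ (Z' : Scheme.{u}) (e : Z' ⟶ Z) (h : H), e ≫ g₁ = e ≫ g₂ ≫ P.act h →
      e ≫ f₁ = e ≫ f₂) : f₁ = f₂ := by
  -- Through the inverse shear, `z` records which group element carries `g₂` to `g₁`; pulling back
  -- the summands covers `Z` by the loci where this element is constant.
  let z : Z ⟶ ∐ fun _ : H ↦ P.total := pullback.lift g₁ g₂ hg ≫ inv P.shear
  refine Scheme.Cover.hom_ext ((sigmaOpenCover fun _ : H ↦ P.total).pullback₁ z) _ _ fun (h : H) ↦ ?_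
  refine hf _ _ h ?_
  change pullback.fst z (Limits.Sigma.ι (fun _ : H ↦ P.total) h) ≫ g₁ =
    pullback.fst z (Limits.Sigma.ι (fun _ : H ↦ P.total) h) ≫ g₂ ≫ P.act h
  have hz : pullback.fst z (Limits.Sigma.ι (fun _ : H ↦ P.total) h) ≫ pullback.lift g₁ g₂ hg =
      pullback.snd z (Limits.Sigma.ι (fun _ : H ↦ P.total) h) ≫ P.shearι h := by
    rw [← cancel_mono (inv P.shear), Category.assoc, Category.assoc, shearι_inv_shear]
    exact pullback.condition
  have h₁ := congr($hz ≫ pullback.fst _ _)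
  have h₂ := congr($hz ≫ pullback.snd _ _)
  simp only [Category.assoc, pullback.lift_fst, pullback.lift_snd, Category.comp_id] at h₁ h₂
  rw [h₁, reassoc_of% h₂]

/-- Invariant morphisms out of the base change of a torsor descend to the base. -/
lemma existsUnique_desc {P' T' X : Scheme.{u}} {θ : P' ⟶ P.total} {p' : P' ⟶ T'} {t : T' ⟶ T}
    (hθ : IsPullback θ p' P.proj t) (act' : H → (P' ⟶ P'))
    (hact : ∀ h, act' h ≫ θ = θ ≫ P.act h) (hact' : ∀ h, act' h ≫ p' = p')
    (f : P' ⟶ X) (hf : ∀ h, act' h ≫ f = f) : ∃! d : T' ⟶ X, p' ≫ d = f := by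
  have : Surjective p' := MorphismProperty.of_isPullback (P := @Surjective) hθ inferInstance
  have : Etale p' := MorphismProperty.of_isPullback (P := @Etale) hθ inferInstance
  -- Two points of `P'` over the same point of `T'` locally differ by a group element, so invariance
  -- makes `f` constant on the fibres of `p'`, an effective epimorphism.
  have key {Z : Scheme.{u}} (g₁ g₂ : Z ⟶ P') (hg : g₁ ≫ p' = g₂ ≫ p') : g₁ ≫ f = g₂ ≫ f := by
    refine P.hom_ext_of_orbit (g₁ := g₁ ≫ θ) (g₂ := g₂ ≫ θ)
      (by simp only [Category.assoc, hθ.w, reassoc_of% hg]) fun Z' e h he ↦ ?_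
    have : e ≫ g₁ = e ≫ g₂ ≫ act' h := by
      refine hθ.hom_ext ?_ ?_
      · simpa only [Category.assoc, hact] using he
      · simp only [Category.assoc, hact', hg]
    rw [reassoc_of% this, hf]
  have E := EffectiveEpi.getStruct p'
  exact ⟨E.desc f key, E.fac f key, fun d hd ↦ E.uniq f key d hd⟩

/-- The ring of invariants of a torsor is the ring of functions on the base. -/
lemma exists_of_invariant (U : T.Opens) (c : Γ(P.total, P.proj ⁻¹ᵁ U))
    (hc : ∀ h, invariants.actHom P.proj P.act P.act_proj U h c = c) : ∃ a, P.proj.app U a = c := by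
  let act' (h : H) := (P.act h).resLE (P.proj ⁻¹ᵁ U) (P.proj ⁻¹ᵁ U)
    (invariants.preimage_le P.proj P.act P.act_proj U h)
  -- Functions are treated as morphisms to the affine line, so that descent of morphisms yields
  -- descent of functions.
  let E (X : Scheme.{u}) := toSpecMvPolyIntEquiv PUnit (X := X)
  obtain ⟨d, hd, -⟩ := P.existsUnique_desc (isPullback_morphismRestrict P.proj U).flip act'
    (fun h ↦ by simp [act'])
    (fun h ↦ by rw [← cancel_mono U.ι]; simp [act', P.act_proj])
    ((E _).symm fun _ ↦ (P.proj ⁻¹ᵁ U).topIso.inv c) fun h ↦ by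
      refine (E _).injective (funext fun i ↦ ?_)
      simp only [E, toSpecMvPolyIntEquiv_comp, Equiv.apply_symm_apply]
      rw [Scheme.Hom.appTop, Scheme.Hom.resLE_app_top]
      simp only [CommRingCat.comp_apply]
      congr 1
      refine Eq.trans ?_ (hc h)
      exact congr(invariants.actHom P.proj P.act P.act_proj U h
        ($((P.proj ⁻¹ᵁ U).topIso.inv_hom_id).hom c))
  refine ⟨U.topIso.hom (E _ d PUnit.unit), ?_⟩
  have := congr(E _ $hd PUnit.unit)
  simp only [E, toSpecMvPolyIntEquiv_comp, Equiv.apply_symm_apply] at this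
  rw [← Scheme.Hom.resLE_eq_morphismRestrict, Scheme.Hom.appTop, Scheme.Hom.resLE_app_top] at this
  have := congr((P.proj ⁻¹ᵁ U).topIso.hom $this)
  simp only [← CommRingCat.comp_apply, Category.assoc, Iso.inv_hom_id, Category.comp_id] at this
  rw [← Scheme.Hom.appLE_eq_app]
  exact this

/-- This is the indicator function of the diagonal, which under the shear isomorphism is the summand
indexed by `1`. -/
lemma exists_idempotent [DecidableEq H] : ∃ ε : Γ(pullback P.proj P.proj, ⊤),
    ∀ h, (P.shearι h).appTop ε = if h = 1 then 1 else 0 := by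
  let f : (∐ fun _ : H ↦ P.total) ⟶ _ := Limits.Sigma.desc fun h ↦
    (toSpecMvPolyIntEquiv PUnit).symm fun _ ↦ if h = 1 then 1 else 0
  refine ⟨toSpecMvPolyIntEquiv PUnit (inv P.shear ≫ f) PUnit.unit, fun h ↦ ?_⟩
  rw [← toSpecMvPolyIntEquiv_comp, ← Category.assoc, shearι_inv_shear]
  simp [f]

/-- A torsor is a Galois extension over affine open subsets. -/
lemma exists_finset [DecidableEq H] {U : T.Opens} (hU : IsAffineOpen U) :
    ∃ s : Finset (Γ(P.total, P.proj ⁻¹ᵁ U) × Γ(P.total, P.proj ⁻¹ᵁ U)),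
      ∀ h, ∑ i ∈ s, i.1 * invariants.actHom P.proj P.act P.act_proj U h i.2 =
        if h = 1 then 1 else 0 := by
  obtain ⟨ε, hε⟩ := P.exists_idempotent
  -- Over affine `U`, sections on `P ×_T P` form a tensor product, so `ε` is a sum of pure tensors.
  -- The flip puts the second projection first: restriction along `shearι h` then leaves `i.1` alone
  -- and applies the action to `i.2`.
  have H := (isIso_pushoutSection_iff (IsPullback.of_hasPullback P.proj P.proj).flip
    (US := U) (UT := P.proj ⁻¹ᵁ U) (UX := P.proj ⁻¹ᵁ U) le_rfl le_rfl rfl).mp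
    (isIso_pushoutSection_of_isAffineOpen _ _ _ _ hU (hU.preimage P.proj) (hU.preimage P.proj))
  set V := pullback.snd P.proj P.proj ⁻¹ᵁ P.proj ⁻¹ᵁ U ⊓ pullback.fst P.proj P.proj ⁻¹ᵁ P.proj ⁻¹ᵁ U
    with hV
  obtain ⟨s, hs⟩ := CommRingCat.exists_finset_of_isPushout H
    ((pullback P.proj P.proj).presheaf.map (homOfLE le_top).op ε)
  refine ⟨s, fun h ↦ ?_⟩
  have hle : P.proj ⁻¹ᵁ U ≤ P.shearι h ⁻¹ᵁ V := by
    have h₁ : P.proj ⁻¹ᵁ U ≤ (P.shearι h ≫ pullback.snd P.proj P.proj) ⁻¹ᵁ P.proj ⁻¹ᵁ U := by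
      rw [pullback.lift_snd]
      exact le_rfl
    have h₂ : P.proj ⁻¹ᵁ U ≤ (P.shearι h ≫ pullback.fst P.proj P.proj) ⁻¹ᵁ P.proj ⁻¹ᵁ U := by
      rw [pullback.lift_fst]
      exact invariants.preimage_le P.proj P.act P.act_proj U h
    exact fun x hx ↦ ⟨h₁ hx, h₂ hx⟩
  have h_snd : (pullback.snd P.proj P.proj).appLE (P.proj ⁻¹ᵁ U) V inf_le_left ≫
      (P.shearι h).appLE V (P.proj ⁻¹ᵁ U) hle = 𝟙 _ := by
    rw [Scheme.Hom.appLE_comp_appLE]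
    simp only [pullback.lift_snd]
    exact P.total.presheaf.map_id _
  have h_fst : (pullback.fst P.proj P.proj).appLE (P.proj ⁻¹ᵁ U) V inf_le_right ≫
      (P.shearι h).appLE V (P.proj ⁻¹ᵁ U) hle =
        invariants.actHom P.proj P.act P.act_proj U h := by
    rw [Scheme.Hom.appLE_comp_appLE]
    simp only [pullback.lift_fst]
    rfl
  have h_map : (pullback P.proj P.proj).presheaf.map (homOfLE le_top).op ≫
      (P.shearι h).appLE V (P.proj ⁻¹ᵁ U) hle =
        (P.shearι h).appTop ≫ P.total.presheaf.map (homOfLE le_top).op := by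
    rw [Scheme.Hom.map_appLE]
    rfl
  have h₁ : (P.shearι h).appLE V (P.proj ⁻¹ᵁ U) hle _ = (P.shearι h).appLE V (P.proj ⁻¹ᵁ U) hle _ :=
    congr_arg _ hs
  have h₂ : P.total.presheaf.map (homOfLE (le_top (a := P.proj ⁻¹ᵁ U))).op _ =
    P.total.presheaf.map (homOfLE (le_top (a := P.proj ⁻¹ᵁ U))).op _ := congr_arg _ (hε h)
  rw [apply_ite (P.total.presheaf.map (homOfLE _).op), _root_.map_one, _root_.map_zero] at h₂
  rw [← h₂]
  rw [_root_.map_sum] at h₁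
  refine Eq.trans (Finset.sum_congr rfl fun i _ ↦ ?_) (h₁.symm.trans congr($h_map ε))
  rw [_root_.map_mul]
  congr 1
  · exact congr($h_snd.symm i.1)
  · exact congr($h_fst.symm i.2)

end Torsor

end StackTheory

/-! ### Base change of the quotient to the torsor. -/

namespace AlgebraicGeometry

/-- Being a pullback square can be checked on an open cover of one factor. -/
lemma isPullback_of_isOpenCover {ι : Type u} {X Y Z W : Scheme.{u}} {fWX : W ⟶ X} {fWY : W ⟶ Y}
    {fXZ : X ⟶ Z} {fYZ : Y ⟶ Z} (U : ι → X.Opens) (hU : TopologicalSpace.IsOpenCover U)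
    (H : ∀ i, IsPullback (fWX ∣_ U i) ((fWX ⁻¹ᵁ U i).ι ≫ fWY) ((U i).ι ≫ fXZ) fYZ) :
    IsPullback fWX fWY fXZ fYZ := by
  refine Scheme.isPullback_of_openCover _ _ _ _ (X.openCoverOfIsOpenCover U hU) fun (i : ι) ↦ ?_
  change IsPullback (pullback.snd fWX (U i).ι) (pullback.fst fWX (U i).ι ≫ fWY) ((U i).ι ≫ fXZ) fYZ
  refine (H i).of_iso (pullbackRestrictIsoRestrict fWX (U i)).symm (Iso.refl _) (Iso.refl _)
    (Iso.refl _) ?_ ?_ (by simp) (by simp)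
  · rw [Iso.symm_hom, Iso.eq_inv_comp, ← cancel_mono (U i).ι]
    simp
  · rw [Iso.symm_hom, Iso.refl_hom, Category.comp_id, Iso.eq_inv_comp, ← Category.assoc,
      pullbackRestrictIsoRestrict_hom_ι]

namespace invariants

/-- Passing to functions reverses composition, giving the order of factors used in the Galois
descent statement. -/
lemma actHom_mul {H : Type w} [Group H] {W T : Scheme.{u}}
    (π : W ⟶ T) (act : H → (W ⟶ W))
    (hact : ∀ h, act h ≫ π = π) (act_mul : ∀ g h, act (g * h) = act h ≫ act g) (U : T.Opens)
    (g h : H) : actHom π act hact U (g * h) = actHom π act hact U g ≫ actHom π act hact U h := by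
  simp only [actHom, Scheme.Hom.appLE_comp_appLE, act_mul]

lemma actHom_one {H : Type w} [Group H] {W T : Scheme.{u}}
    (π : W ⟶ T) (act : H → (W ⟶ W))
    (hact : ∀ h, act h ≫ π = π) (act_one : act 1 = 𝟙 W) (U : T.Opens) :
    actHom π act hact U 1 = 𝟙 _ := by
  simp only [actHom, act_one]
  exact W.presheaf.map_id _

lemma app_actHom_of_equivariant {H : Type w} {W P T : Scheme.{u}} (w : W ⟶ P) (p : P ⟶ T)
    (act : H → (W ⟶ W)) (act' : H → (P ⟶ P)) (hact : ∀ h, act h ≫ w ≫ p = w ≫ p)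
    (hact' : ∀ h, act' h ≫ p = p) (h_eq : ∀ h, act h ≫ w = w ≫ act' h) (U : T.Opens) (h : H) :
    w.app (p ⁻¹ᵁ U) ≫ actHom (w ≫ p) act hact U h = actHom p act' hact' U h ≫ w.app (p ⁻¹ᵁ U) := by
  have h₁ : w.appLE (p ⁻¹ᵁ U) (w ⁻¹ᵁ p ⁻¹ᵁ U) le_rfl ≫ actHom (w ≫ p) act hact U h =
      actHom p act' hact' U h ≫ w.appLE (p ⁻¹ᵁ U) (w ⁻¹ᵁ p ⁻¹ᵁ U) le_rfl := by
    refine (Scheme.Hom.appLE_comp_appLE _ _ _ _ _ _ _).trans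
      (Eq.trans ?_ (Scheme.Hom.appLE_comp_appLE _ _ _ _ _ _ _).symm)
    simp only [h_eq]
  rwa [Scheme.Hom.appLE_eq_app] at h₁

end invariants

end AlgebraicGeometry

namespace StackTheory

namespace Torsor

variable {H : Type w} [Group H] [Finite H] {T : Scheme.{u}} (P : Torsor H T) {W : Scheme.{u}}
  (w : W ⟶ P.total) (act : H → (W ⟶ W)) (act_one : act 1 = 𝟙 W)
  (act_mul : ∀ g h, act (g * h) = act h ≫ act g) (hact : ∀ h, act h ≫ w = w ≫ P.act h)
  (hact' : ∀ h, act h ≫ w ≫ P.proj = w ≫ P.proj)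

open invariants

include act_one act_mul hact in
-- Galois descent for the extension of rings given by the torsor over `U`, with
-- `exists_of_invariant` and `exists_finset` as input.
lemma isPushout_invariants [IsAffineHom w] {U : T.Opens} (hU : IsAffineOpen U) :
    IsPushout (P.proj.app U) (baseToSubring (w ≫ P.proj) act hact' U) (w.app (P.proj ⁻¹ᵁ U))
      (CommRingCat.ofHom (subring (w ≫ P.proj) act hact' U).subtype) := by
  classical
  cases nonempty_fintype H
  let : Algebra Γ(T, U) Γ(P.total, P.proj ⁻¹ᵁ U) := (P.proj.app U).hom.toAlgebra
  let : Algebra Γ(T, U) (subring (w ≫ P.proj) act hact' U) :=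
    (baseToSubring (w ≫ P.proj) act hact' U).hom.toAlgebra
  let : Algebra Γ(P.total, P.proj ⁻¹ᵁ U) Γ(W, (w ≫ P.proj) ⁻¹ᵁ U) :=
    (w.app (P.proj ⁻¹ᵁ U)).hom.toAlgebra
  let : Algebra Γ(T, U) Γ(W, (w ≫ P.proj) ⁻¹ᵁ U) := ((w ≫ P.proj).app U).hom.toAlgebra
  have : IsScalarTower Γ(T, U) Γ(P.total, P.proj ⁻¹ᵁ U) Γ(W, (w ≫ P.proj) ⁻¹ᵁ U) :=
    .of_algebraMap_eq' <| by
      simp only [RingHom.algebraMap_toAlgebra, Scheme.Hom.comp_app]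
      rfl
  have : IsScalarTower Γ(T, U) (subring (w ≫ P.proj) act hact' U) Γ(W, (w ≫ P.proj) ⁻¹ᵁ U) :=
    .of_algebraMap_eq' rfl
  obtain ⟨s, hs⟩ := P.exists_finset hU
  have : Algebra.IsPushout Γ(T, U) Γ(P.total, P.proj ⁻¹ᵁ U) (subring (w ≫ P.proj) act hact' U)
      Γ(W, (w ≫ P.proj) ⁻¹ᵁ U) :=
    Algebra.isPushout_of_invariants
      (fun h ↦ (actHom P.proj P.act P.act_proj U h).hom)
      (fun h ↦ (actHom (w ≫ P.proj) act hact' U h).hom)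
      (fun g h c ↦ congr($(actHom_mul P.proj P.act P.act_proj P.act_mul U g h).hom c))
      (fun g h c ↦ congr($(actHom_mul (w ≫ P.proj) act hact' act_mul U g h).hom c))
      (fun c ↦ congr($(actHom_one P.proj P.act P.act_proj P.act_one U).hom c))
      (fun c ↦ congr($(actHom_one (w ≫ P.proj) act hact' act_one U).hom c))
      (fun h c ↦ congr($(app_actHom_of_equivariant w P.proj act P.act hact' P.act_proj hact U h).hom c))
      (fun c hc ↦ P.exists_of_invariant U c hc)
      Subtype.val_injective
      (fun h d ↦ mem_invariantSubring.mp d.2 h)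
      (fun b hb ↦ ⟨⟨b, mem_invariantSubring.mpr hb⟩, rfl⟩)
      s hs
  exact CommRingCat.isPushout_of_isPushout Γ(T, U) Γ(P.total, P.proj ⁻¹ᵁ U)
    (subring (w ≫ P.proj) act hact' U) Γ(W, (w ≫ P.proj) ⁻¹ᵁ U)

include act_one act_mul hact in
-- The spectrum of the pushout of invariants is pasted onto the chart of the quotient over `U`.
lemma isPullback_toQuotient_of_isAffineOpen [IsAffineHom w] {U : T.Opens} (hU : IsAffineOpen U) :
    IsPullback (w ∣_ (P.proj ⁻¹ᵁ U))
      ((w ⁻¹ᵁ P.proj ⁻¹ᵁ U).ι ≫ toQuotient (w ≫ P.proj) act hact') ((P.proj ⁻¹ᵁ U).ι ≫ P.proj)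
      (quotientToBase (w ≫ P.proj) act hact') := by
  have h₁ := isPullback_SpecMap_of_isPushout _ _ _ _
    (P.isPushout_invariants w act act_one act_mul hact hact' hU)
  have hP := hU.preimage P.proj
  have hW := hP.preimage w
  have h₂ := h₁.paste_vert (isPullback_quotientι (w ≫ P.proj) act hact' hU).flip
  refine h₂.of_iso hW.isoSpec.symm hP.isoSpec.symm (Iso.refl _) (Iso.refl _) ?_ ?_ ?_ ?_
  · rw [Iso.symm_hom, Iso.symm_hom, Iso.eq_inv_comp, ← Category.assoc, Iso.comp_inv_eq,
      IsAffineOpen.isoSpec_hom, IsAffineOpen.isoSpec_hom]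
    exact Scheme.Opens.toSpecΓ_naturality w (P.proj ⁻¹ᵁ U)
  · rw [Iso.refl_hom, Category.comp_id, Iso.symm_hom, Iso.eq_inv_comp, IsAffineOpen.isoSpec_hom]
    exact (ι_toQuotient (w ≫ P.proj) act hact' hU).symm
  · rw [Iso.refl_hom, Category.comp_id, Iso.symm_hom, Iso.eq_inv_comp, IsAffineOpen.isoSpec_hom,
      Scheme.Opens.toSpecΓ_naturality_assoc, IsAffineOpen.toSpecΓ_fromSpec, morphismRestrict_ι]
  · simp

include act_one act_mul hact in
/-- A quotient of a scheme equivariantly affine over a torsor has the scheme as its base change. -/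
theorem isPullback_toQuotient [IsAffineHom w] :
    IsPullback w (toQuotient (w ≫ P.proj) act hact') P.proj
      (quotientToBase (w ≫ P.proj) act hact') :=
  isPullback_of_isOpenCover (fun U : T.affineOpens ↦ P.proj ⁻¹ᵁ U)
    (.comap (iSup_affineOpens_eq_top T) P.proj.base.1)
    fun U ↦ P.isPullback_toQuotient_of_isAffineOpen w act act_one act_mul hact hact' U.2

end Torsor

/-! ### The scheme of isomorphisms of two torsors. -/

namespace Torsor

variable {H : Type w} [Group H] [Finite H] {T : Scheme.{u}} (P Q : Torsor H T)

/-- A free `π` allows one quotient of `P ×_T Q` to be compared with both `P` and `Q`, whose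
composites to `T` are only propositionally equal. -/
lemma isPullback_toQuotient_of_comp_eq {W : Scheme.{u}} (w : W ⟶ P.total) [IsAffineHom w]
    (act : H → (W ⟶ W)) (act_one : act 1 = 𝟙 W) (act_mul : ∀ g h, act (g * h) = act h ≫ act g)
    (hact : ∀ h, act h ≫ w = w ≫ P.act h) {π : W ⟶ T} (hπ : w ≫ P.proj = π)
    (hact' : ∀ h, act h ≫ π = π) [QuasiCompact π] [QuasiSeparated π] :
    IsPullback w (toQuotient π act hact') P.proj (quotientToBase π act hact') := by
  subst hπ
  exact P.isPullback_toQuotient w act act_one act_mul hact hact'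

/-- The diagonal action on the product of two torsors. -/
noncomputable def prodAct (h : H) : pullback P.proj Q.proj ⟶ pullback P.proj Q.proj :=
  pullback.lift (pullback.fst _ _ ≫ P.act h) (pullback.snd _ _ ≫ Q.act h)
    (by simp [P.act_proj, Q.act_proj, pullback.condition])

@[simp]
lemma prodAct_fst (h : H) : P.prodAct Q h ≫ pullback.fst _ _ = pullback.fst _ _ ≫ P.act h :=
  pullback.lift_fst _ _ _

@[simp]
lemma prodAct_fst_assoc (h : H) {Z : Scheme.{u}} (f : P.total ⟶ Z) :
    P.prodAct Q h ≫ pullback.fst _ _ ≫ f = pullback.fst _ _ ≫ P.act h ≫ f := by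
  rw [← Category.assoc, prodAct_fst, Category.assoc]

@[simp]
lemma prodAct_snd (h : H) : P.prodAct Q h ≫ pullback.snd _ _ = pullback.snd _ _ ≫ Q.act h :=
  pullback.lift_snd _ _ _

@[simp]
lemma prodAct_snd_assoc (h : H) {Z : Scheme.{u}} (f : Q.total ⟶ Z) :
    P.prodAct Q h ≫ pullback.snd _ _ ≫ f = pullback.snd _ _ ≫ Q.act h ≫ f := by
  rw [← Category.assoc, prodAct_snd, Category.assoc]

/-- The scheme of isomorphisms of two torsors, as the quotient of their product by the diagonal
action, is finite étale of constant degree, and both torsors become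
isomorphic to the product over it. -/
theorem exists_isomScheme : ∃ (V : Scheme.{u}) (v : V ⟶ T) (q : pullback P.proj Q.proj ⟶ V),
    IsPullback (pullback.fst P.proj Q.proj) q P.proj v ∧
    IsPullback (pullback.snd P.proj Q.proj) q Q.proj v ∧
    (∀ h, P.prodAct Q h ≫ q = q) ∧
    Surjective v ∧ IsFinite v ∧ Etale v ∧ ∀ t, v.finrank t = Nat.card H := by
  have act_one : P.prodAct Q 1 = 𝟙 _ := by ext1 <;> simp [P.act_one, Q.act_one]
  have act_mul (g h : H) : P.prodAct Q (g * h) = P.prodAct Q h ≫ P.prodAct Q g := by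
    ext1 <;> simp [P.act_mul, Q.act_mul]
  have hact (h : H) : P.prodAct Q h ≫ pullback.fst P.proj Q.proj ≫ P.proj =
      pullback.fst P.proj Q.proj ≫ P.proj := by simp [P.act_proj]
  let π := pullback.fst P.proj Q.proj ≫ P.proj
  have : Surjective π :=
    inferInstanceAs (Surjective (pullback.fst P.proj Q.proj ≫ P.proj))
  let q := toQuotient π (P.prodAct Q) hact
  let v := quotientToBase π (P.prodAct Q) hact
  have h₁ : IsPullback (pullback.fst P.proj Q.proj) q P.proj v :=
    P.isPullback_toQuotient_of_comp_eq _ (P.prodAct Q) act_one act_mul (P.prodAct_fst Q) rfl hact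
  have h₂ : IsPullback (pullback.snd P.proj Q.proj) q Q.proj v :=
    Q.isPullback_toQuotient_of_comp_eq _ (P.prodAct Q) act_one act_mul (P.prodAct_snd Q)
      pullback.condition.symm hact
  obtain ⟨_, _⟩ := isFinite_and_etale_of_isPullback h₁
  have hqv : q ≫ v = π := toQuotient_toBase π (P.prodAct Q) hact
  have : Surjective (q ≫ v) := by rwa [hqv]
  refine ⟨_, v, q, h₁, h₂, act_toQuotient π (P.prodAct Q) hact, .of_comp q v, inferInstance,
    inferInstance, fun t ↦ ?_⟩
  -- The rank can be read off after pulling back to `P`, where `v` becomes a base change of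
  -- `Q.proj`.
  obtain ⟨p, rfl⟩ := P.proj.surjective t
  rw [← Scheme.Hom.finrank_of_isPullback _ _ _ _ h₁.flip, Scheme.Hom.finrank_pullback_fst,
    finrank_proj]

end Torsor

/-! ### Morphisms of `BH` over a fixed morphism of the base. -/

namespace BObj

variable {S : Scheme.{u}} {H : Type w} [Group H] [Finite H]

/-- The projection of the torsor of an object lying over `U`. -/
def projTo (a : BObj S H) {U : Over S} (h : a.base = U) : a.torsor.total ⟶ U.left :=
  a.torsor.proj ≫ (eqToHom h).left

variable {a b : BObj S H} {U V : Over S}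

lemma isPullback_of_isHomLift (g : U ⟶ V) (φ : a ⟶ b) [hφ : (bProj S H).IsHomLift g φ]
    (ha : a.base = U) (hb : b.base = V) :
    IsPullback (BHom.total φ) (a.projTo ha) (b.projTo hb) g.left := by
  subst ha hb
  obtain rfl : g = BHom.base φ := @IsHomLift.eq_of_isHomLift _ _ _ _ (bProj S H) _ _ g φ hφ
  simpa [projTo] using BHom.isPullback φ

lemma exists_lift (g : U ⟶ V) (ha : a.base = U) (hb : b.base = V)
    (k : a.torsor.total ⟶ b.torsor.total) (hk : ∀ h, a.torsor.act h ≫ k = k ≫ b.torsor.act h)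
    (hk' : IsPullback k (a.projTo ha) (b.projTo hb) g.left) :
    ∃ φ : a ⟶ b, (bProj S H).IsHomLift g φ ∧ BHom.total φ = k := by
  subst ha hb
  let φ : BHom a b := ⟨g, k, hk, by simpa [projTo] using hk'⟩
  exact ⟨φ, CategoryTheory.IsHomLift.map (bProj S H) φ, rfl⟩

lemma hom_ext_of_total (g : U ⟶ V) {φ ψ : a ⟶ b} [hφ : (bProj S H).IsHomLift g φ]
    [hψ : (bProj S H).IsHomLift g ψ] (h : BHom.total φ = BHom.total ψ) : φ = ψ := by
  obtain rfl := IsHomLift.domain_eq (bProj S H) g φ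
  obtain rfl := IsHomLift.codomain_eq (bProj S H) g φ
  exact BHom.ext ((IsHomLift.eq_of_isHomLift (bProj S H) g φ).symm.trans
    (IsHomLift.eq_of_isHomLift (bProj S H) g ψ)) h

lemma isIso_of_isHomLift_id (φ : a ⟶ b) [hφ : (bProj S H).IsHomLift (𝟙 U) φ] : IsIso φ := by
  have ha := IsHomLift.domain_eq (bProj S H) (𝟙 U) φ
  have hb := IsHomLift.codomain_eq (bProj S H) (𝟙 U) φ
  change a.base = U at ha
  change b.base = U at hb
  have h := isPullback_of_isHomLift (𝟙 U) φ ha hb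
  have : IsIso (𝟙 U : U ⟶ U).left := by rw [Over.id_left]; infer_instance
  have : IsIso (BHom.total φ) := h.isIso_fst_of_isIso
  obtain ⟨ψ, h₁, h₂⟩ := exists_lift (𝟙 U) hb ha (inv (BHom.total φ))
    (fun h ↦ by rw [IsIso.comp_inv_eq, Category.assoc, IsIso.eq_inv_comp, BHom.equivariant φ])
    (.of_horiz_isIso ⟨by rw [IsIso.inv_comp_eq, ← Category.assoc, h.w]; simp⟩)
  have := IsHomLift.id (p := bProj S H) ha
  have := IsHomLift.id (p := bProj S H) hb
  refine ⟨ψ, hom_ext_of_total (𝟙 U) ?_, hom_ext_of_total (𝟙 U) ?_⟩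
  · change BHom.total φ ≫ BHom.total ψ = 𝟙 _
    simp [h₂]
  · change BHom.total ψ ≫ BHom.total φ = 𝟙 _
    simp [h₂]

/-- Objects over the same base are cartesian: lifts along the same morphism agree if they agree
after composition. -/
lemma hom_ext_of_comp {c : BObj S H} (g : U ⟶ V) {φ₁ φ₂ : a ⟶ b} [(bProj S H).IsHomLift g φ₁]
    [(bProj S H).IsHomLift g φ₂] (ψ : b ⟶ c) (h : φ₁ ≫ ψ = φ₂ ≫ ψ) : φ₁ = φ₂ := by
  have hb := IsHomLift.codomain_eq (bProj S H) g φ₁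
  have ha := IsHomLift.domain_eq (bProj S H) g φ₁
  subst ha hb
  refine hom_ext_of_total g ((BHom.isPullback ψ).hom_ext congr(BHom.total $h) ?_)
  rw [(BHom.isPullback φ₁).w, (BHom.isPullback φ₂).w]
  congr 2
  exact (IsHomLift.eq_of_isHomLift (bProj S H) g φ₁).symm.trans
    (IsHomLift.eq_of_isHomLift (bProj S H) g φ₂)

/-- Transport of the torsor of an object to the base it lies over. -/
lemma exists_torsor (a : BObj S H) (h : a.base = U) : ∃ (P : Torsor H U.left)
    (e : a.torsor.total ≅ P.total), (∀ h, a.torsor.act h ≫ e.hom = e.hom ≫ P.act h) ∧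
      e.hom ≫ P.proj = a.projTo h := by
  subst h
  exact ⟨a.torsor, Iso.refl _, by simp, by simp [projTo]⟩

end BObj

/-! ### Isomorphisms of torsors as points of the scheme of isomorphisms. -/

section

variable {S : Scheme.{u}} {H : Type w} [Group H] [Finite H]

/-- A morphism from an object of `BH` over `U` to a torsor over a scheme `X`, lying over a morphism
`U ⟶ X`. -/
structure BObj.IsChart (a : BObj S H) {U : Over S} (ha : a.base = U) {X : Scheme.{u}}
    (P : Torsor H X) (t : U.left ⟶ X) (θ : a.torsor.total ⟶ P.total) : Prop where
  isPullback : IsPullback θ (a.projTo ha) P.proj t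
  equivariant (h : H) : a.torsor.act h ≫ θ = θ ≫ P.act h

lemma BObj.act_projTo (a : BObj S H) {U : Over S} (ha : a.base = U) (h : H) :
    a.torsor.act h ≫ a.projTo ha = a.projTo ha := by
  rw [projTo, ← Category.assoc, a.torsor.act_proj]

/-- A scheme of isomorphisms of two torsors. -/
structure IsIsomScheme {X : Scheme.{u}} (P Q : Torsor H X) {V : Scheme.{u}} (v : V ⟶ X)
    (q : pullback P.proj Q.proj ⟶ V) : Prop where
  isPullback_fst : IsPullback (pullback.fst P.proj Q.proj) q P.proj v
  isPullback_snd : IsPullback (pullback.snd P.proj Q.proj) q Q.proj v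
  invariant (h : H) : P.prodAct Q h ≫ q = q

variable {X V : Scheme.{u}} {P Q : Torsor H X} {v : V ⟶ X} {q : pullback P.proj Q.proj ⟶ V}
  {a b : BObj S H} {U : Over S} {ha : a.base = U} {hb : b.base = U} {t : U.left ⟶ X}
  {θ : a.torsor.total ⟶ P.total} {θ' : b.torsor.total ⟶ Q.total}

/-- The relation between morphisms of torsors and points of the scheme of isomorphisms. -/
def IsomRel (q : pullback P.proj Q.proj ⟶ V) (ha : a.base = U) (θ : a.torsor.total ⟶ P.total)
    (θ' : b.torsor.total ⟶ Q.total) (u : U.left ⟶ V) (φ : a ⟶ b) : Prop :=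
  ∃ z : a.torsor.total ⟶ pullback P.proj Q.proj, z ≫ pullback.fst _ _ = θ ∧
    z ≫ pullback.snd _ _ = BHom.total φ ≫ θ' ∧ z ≫ q = a.projTo ha ≫ u

namespace IsIsomScheme

variable (hV : IsIsomScheme P Q v q) (hθ : a.IsChart ha P t θ) (hθ' : b.IsChart hb Q t θ')

include hV in
lemma w : q ≫ v = pullback.fst _ _ ≫ P.proj := hV.isPullback_fst.w.symm

include hV hθ hθ' in
-- Since `P ×_T Q` is the base change of `P` to `V`, the pair `(θ, u)` defines the graph `z`. Its
-- second component is equivariant and cartesian because `P ×_T Q` is also the base change of `Q`,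
-- so it factors through `b` as the desired morphism.
lemma exists_hom (u : U.left ⟶ V) (hu : u ≫ v = t) :
    ∃ φ : a ⟶ b, (bProj S H).IsHomLift (𝟙 U) φ ∧ IsomRel q ha θ θ' u φ := by
  let z := hV.isPullback_fst.lift θ (a.projTo ha ≫ u) (by rw [hθ.isPullback.w, Category.assoc, hu])
  have hz₁ : z ≫ pullback.fst _ _ = θ := hV.isPullback_fst.lift_fst _ _ _
  have hz₂ : z ≫ q = a.projTo ha ≫ u := hV.isPullback_fst.lift_snd _ _ _
  have hz : IsPullback z (a.projTo ha) q u := by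
    refine .of_right (h₁₂ := pullback.fst _ _) (h₂₂ := v) ?_ hz₂ hV.isPullback_fst
    rw [hz₁, hu]
    exact hθ.isPullback
  have hz' : IsPullback (z ≫ pullback.snd _ _) (a.projTo ha) Q.proj t := by
    rw [← hu]
    exact hz.paste_horiz hV.isPullback_snd
  let k := hθ'.isPullback.lift (z ≫ pullback.snd _ _) (a.projTo ha) hz'.w
  have hk₁ : k ≫ θ' = z ≫ pullback.snd _ _ := hθ'.isPullback.lift_fst _ _ _
  have hk₂ : k ≫ b.projTo hb = a.projTo ha := hθ'.isPullback.lift_snd _ _ _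
  have hz_act (h : H) : a.torsor.act h ≫ z = z ≫ P.prodAct Q h := by
    refine hV.isPullback_fst.hom_ext ?_ ?_
    · simp [hz₁, reassoc_of% hz₁, hθ.equivariant]
    · rw [Category.assoc, Category.assoc, hV.invariant, hz₂, ← Category.assoc, a.act_projTo]
  obtain ⟨φ, h₁, h₂⟩ := BObj.exists_lift (𝟙 U) ha hb k (fun h ↦ by
      refine hθ'.isPullback.hom_ext ?_ ?_
      · simp only [Category.assoc, hk₁, hθ'.equivariant, reassoc_of% hz_act, Torsor.prodAct_snd]
        rw [reassoc_of% hk₁]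
      · simp only [Category.assoc, hk₂, BObj.act_projTo]) (by
      refine .of_right (h₁₂ := θ') (h₂₂ := t) ?_ (by rw [hk₂, Over.id_left, Category.comp_id])
        hθ'.isPullback
      rwa [hk₁, Over.id_left, Category.id_comp])
  exact ⟨φ, h₁, z, hz₁, by rw [h₂, hk₁], hz₂⟩

include hV hθ' in
lemma hom_unique {u : U.left ⟶ V} {φ φ' : a ⟶ b} (_ : (bProj S H).IsHomLift (𝟙 U) φ)
    (_ : (bProj S H).IsHomLift (𝟙 U) φ') (h : IsomRel q ha θ θ' u φ)
    (h' : IsomRel q ha θ θ' u φ') : φ = φ' := by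
  obtain ⟨z, h₁, h₂, h₃⟩ := h
  obtain ⟨z', h₁', h₂', h₃'⟩ := h'
  obtain rfl : z = z' := hV.isPullback_fst.hom_ext (h₁.trans h₁'.symm) (h₃.trans h₃'.symm)
  refine BObj.hom_ext_of_total (𝟙 U) (hθ'.isPullback.hom_ext (h₂.symm.trans h₂') ?_)
  rw [(BObj.isPullback_of_isHomLift (𝟙 U) φ ha hb).w,
    (BObj.isPullback_of_isHomLift (𝟙 U) φ' ha hb).w]

include hθ in
-- The morphism determines its graph, and the composite of the graph with `q` descends uniquely to
-- `U`.
lemma point_unique {u u' : U.left ⟶ V} {φ : a ⟶ b} (h : IsomRel q ha θ θ' u φ)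
    (h' : IsomRel q ha θ θ' u' φ) : u = u' := by
  obtain ⟨z, h₁, h₂, h₃⟩ := h
  obtain ⟨z', h₁', h₂', h₃'⟩ := h'
  obtain rfl : z = z' := pullback.hom_ext (h₁.trans h₁'.symm) (h₂.trans h₂'.symm)
  obtain ⟨_, -, h⟩ := P.existsUnique_desc hθ.isPullback a.torsor.act hθ.equivariant
    (a.act_projTo ha) (z ≫ q) (fun h ↦ by rw [h₃, ← Category.assoc, a.act_projTo])
  exact (h _ h₃.symm).trans (h _ h₃'.symm).symm

include hV hθ hθ' in
-- The graph of `φ` is equivariant for the diagonal action, so composing with the invariant map `q`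
-- gives an invariant morphism, which descends to `U`.
lemma exists_point (φ : a ⟶ b) (_ : (bProj S H).IsHomLift (𝟙 U) φ) :
    ∃ u : U.left ⟶ V, u ≫ v = t ∧ IsomRel q ha θ θ' u φ := by
  have hφ := (BObj.isPullback_of_isHomLift (𝟙 U) φ ha hb).w
  rw [Over.id_left, Category.comp_id] at hφ
  let z : a.torsor.total ⟶ pullback P.proj Q.proj := pullback.lift θ (BHom.total φ ≫ θ') (by
    rw [hθ.isPullback.w, Category.assoc, hθ'.isPullback.w, reassoc_of% hφ])
  have hz_act (h : H) : a.torsor.act h ≫ z = z ≫ P.prodAct Q h := by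
    refine pullback.hom_ext ?_ ?_
    · simp only [z, Category.assoc, Torsor.prodAct_fst, pullback.lift_fst, pullback.lift_fst_assoc,
        hθ.equivariant]
    · simp only [z, Category.assoc, Torsor.prodAct_snd, pullback.lift_snd, pullback.lift_snd_assoc,
        reassoc_of% BHom.equivariant φ, hθ'.equivariant]
  obtain ⟨u, hu, -⟩ := P.existsUnique_desc hθ.isPullback a.torsor.act hθ.equivariant
    (a.act_projTo ha) (z ≫ q) (fun h ↦ by rw [← Category.assoc, hz_act, Category.assoc, hV.invariant])
  -- Only uniqueness is used here: it lets `u ≫ v = t` be checked after composition with the torsor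
  -- projection.
  obtain ⟨_, -, h⟩ := P.existsUnique_desc hθ.isPullback a.torsor.act hθ.equivariant
    (a.act_projTo ha) (a.projTo ha ≫ t) (fun h ↦ by rw [← Category.assoc, a.act_projTo])
  refine ⟨u, (h _ ?_).trans (h _ rfl).symm, z, pullback.lift_fst _ _ _, pullback.lift_snd _ _ _,
    hu.symm⟩
  change a.projTo ha ≫ u ≫ v = _
  rw [← Category.assoc, hu, Category.assoc, hV.w, pullback.lift_fst_assoc, hθ.isPullback.w]

include hV in
lemma naturality {a' b' : BObj S H} {U' : Over S} {ha' : a'.base = U'} {hb' : b'.base = U'}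
    {t' : U'.left ⟶ X} {θ₁ : a'.torsor.total ⟶ P.total} {θ₁' : b'.torsor.total ⟶ Q.total}
    (hθ₁' : b'.IsChart hb' Q t' θ₁') (g : U ⟶ U') (γ : a ⟶ a') (δ : b ⟶ b')
    (_ : (bProj S H).IsHomLift g γ) (_ : (bProj S H).IsHomLift g δ)
    (hγ : BHom.total γ ≫ θ₁ = θ) (hδ : BHom.total δ ≫ θ₁' = θ') {u : U'.left ⟶ V} {φ : a ⟶ b}
    {φ' : a' ⟶ b'} (hφ : (bProj S H).IsHomLift (𝟙 U) φ) (hφ' : (bProj S H).IsHomLift (𝟙 U') φ')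
    (h : IsomRel q ha θ θ' (g.left ≫ u) φ) (h' : IsomRel q ha' θ₁ θ₁' u φ') :
    γ ≫ φ' = φ ≫ δ := by
  obtain ⟨z, h₁, h₂, h₃⟩ := h
  obtain ⟨z', h₁', h₂', h₃'⟩ := h'
  have hz : BHom.total γ ≫ z' = z := hV.isPullback_fst.hom_ext
    (by rw [Category.assoc, h₁', hγ, h₁])
    (by rw [Category.assoc, h₃', h₃, ← Category.assoc, ← Category.assoc,
      (BObj.isPullback_of_isHomLift g γ ha ha').w])
  refine BObj.hom_ext_of_total g ?_
  have hl : (bProj S H).IsHomLift g (γ ≫ φ') := inferInstance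
  have hr : (bProj S H).IsHomLift g (φ ≫ δ) := inferInstance
  refine hθ₁'.isPullback.hom_ext ?_ ?_
  · change (BHom.total γ ≫ BHom.total φ') ≫ _ = (BHom.total φ ≫ BHom.total δ) ≫ _
    rw [Category.assoc, Category.assoc, hδ, ← h₂, ← h₂', ← hz, Category.assoc]
  · rw [(BObj.isPullback_of_isHomLift g (γ ≫ φ') ha hb').w,
      (BObj.isPullback_of_isHomLift g (φ ≫ δ) ha hb').w]

end IsIsomScheme

end

/-! ### Torsors on a represented category. -/

variable {S : Scheme.{u}} {H : Type w} [Group H] [Finite H]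

lemma isHomLift_map_of_rep {T : Over S} (α : BasedFunctor (rep T) (classifyingStack S H))
    {f f' : Over T} (g : f ⟶ f') : (bProj S H).IsHomLift g.left (α.map g) := by
  have : (Over.forget T).IsHomLift g.left g := CategoryTheory.IsHomLift.map (Over.forget T) g
  exact BasedFunctor.preserves_isHomLift α g.left g

/-- A torsor on the represented category is pulled back from the torsor over the representing
object. -/
lemma exists_charts {T : Over S} (α : BasedFunctor (rep T) (classifyingStack S H)) :
    ∃ (P : Torsor H T.left) (θ : ∀ f : Over T, (BObj.torsor (α.obj f)).total ⟶ P.total),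
      (∀ f : Over T, BObj.IsChart (α.obj f) (α.w_obj f) P f.hom.left (θ f)) ∧
      ∀ {f f' : Over T} (g : f ⟶ f'), BHom.total (α.map g) ≫ θ f' = θ f := by
  -- The torsor is the value at the identity of `T`, the terminal object of the slice; the charts
  -- come from the morphisms to it.
  obtain ⟨P, e, he, hp⟩ := BObj.exists_torsor (U := T) (α.obj (Over.mk (𝟙 T)))
    (α.w_obj (Over.mk (𝟙 T)))
  refine ⟨P, fun f ↦ BHom.total (α.map (Over.mkIdTerminal.from f)) ≫ e.hom, fun f ↦ ⟨?_, ?_⟩, ?_⟩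
  · have h := @BObj.isPullback_of_isHomLift _ _ _ _ _ _ _ _ _ _
      (isHomLift_map_of_rep α (Over.mkIdTerminal.from f)) (α.w_obj f)
      (α.w_obj (Over.mk (𝟙 T)))
    have h' := h.paste_horiz (h₁₂ := e.hom) (h₂₂ := 𝟙 T.left) (v₁₃ := P.proj)
      (.of_horiz_isIso ⟨hp.trans (Category.comp_id _).symm⟩)
    have hf : (Over.mkIdTerminal.from f).left = f.hom := by simp
    rw [hf, Category.comp_id] at h'
    exact h'
  · intro h
    rw [← Category.assoc, BHom.equivariant, Category.assoc, he, Category.assoc]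
  · intro f f' g
    rw [← Category.assoc]
    congr 1
    have : α.map (Over.mkIdTerminal.from f) = α.map g ≫ α.map (Over.mkIdTerminal.from f') := by
      rw [← α.map_comp]
      congr 1
      exact Over.mkIdTerminal.hom_ext _ _
    rw [this]
    rfl

/-- A scheme over `T` representing the isomorphisms between two torsors on the represented category
of `T`. -/
structure IsomRepresentation {T : Over S} (α β : BasedFunctor (rep T) (classifyingStack S H))
    {V : Over S} (v : V ⟶ T) where
  iso (f : Over T) (u : f.left ⟶ V) (hu : u ≫ v = f.hom) : α.obj f ≅ β.obj f
  isHomLift (f : Over T) (u : f.left ⟶ V) (hu : u ≫ v = f.hom) :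
    (bProj S H).IsHomLift (𝟙 f.left) (iso f u hu).hom
  injective (f : Over T) (u : f.left ⟶ V) (hu : u ≫ v = f.hom) (u' : f.left ⟶ V)
    (hu' : u' ≫ v = f.hom) : iso f u hu = iso f u' hu' → u = u'
  surjective (f : Over T) (ι : α.obj f ≅ β.obj f) :
    (bProj S H).IsHomLift (𝟙 f.left) ι.hom → ∃ u hu, iso f u hu = ι
  naturality {f f' : Over T} (g : f ⟶ f') (u : f'.left ⟶ V) (hu : u ≫ v = f'.hom)
    (hu' : (g.left ≫ u) ≫ v = f.hom) :
    α.map g ≫ (iso f' u hu).hom = (iso f (g.left ≫ u) hu').hom ≫ β.map g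

/-- Isomorphisms between two torsors on the represented category of `T` are represented by a
finite étale `T`-scheme. -/
theorem exists_isomRepresentation {T : Over S}
    (α β : BasedFunctor (rep T) (classifyingStack S H)) :
    ∃ (V : Over S) (v : V ⟶ T), Nonempty (IsomRepresentation α β v) ∧
      Surjective v.left ∧ IsFinite v.left ∧ Etale v.left ∧
      ∀ t, Scheme.Hom.finrank v.left t = Nat.card H := by
  obtain ⟨P, θ, hθ, hθm⟩ := exists_charts α
  obtain ⟨Q, θ', hθ', hθm'⟩ := exists_charts β
  obtain ⟨V₀, v₀, q, hq₁, hq₂, hq, hsurj, hfin, het, hrk⟩ := Torsor.exists_isomScheme P Q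
  have hV : IsIsomScheme P Q v₀ q := ⟨hq₁, hq₂, hq⟩
  let V : Over S := Over.mk (v₀ ≫ T.hom)
  let v : V ⟶ T := Over.homMk v₀
  have hu₀ {f : Over T} {u : f.left ⟶ V} (hu : u ≫ v = f.hom) : u.left ≫ v₀ = f.hom.left :=
    congr($(hu).left)
  choose φ hφ₁ hφ₂ using fun (f : Over T) (u : f.left ⟶ V) (hu : u ≫ v = f.hom) ↦
    hV.exists_hom (hθ f) (hθ' f) u.left (hu₀ hu)
  have hiso f u hu : IsIso (φ f u hu) :=
    @BObj.isIso_of_isHomLift_id _ _ _ _ _ _ _ _ (hφ₁ f u hu)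
  refine ⟨V, v, ⟨⟨fun f u hu ↦ @asIso _ _ _ _ (φ f u hu) (hiso f u hu), hφ₁, ?_, ?_, ?_⟩⟩,
    hsurj, hfin, het, hrk⟩
  · intro f u hu u' hu' h
    have h' : φ f u hu = φ f u' hu' := congr(($h).hom)
    refine Over.OverMorphism.ext (IsIsomScheme.point_unique (hθ f) (hφ₂ f u hu) ?_)
    rw [h']
    exact hφ₂ f u' hu'
  · intro f ι hι
    obtain ⟨u, hu, h⟩ := hV.exists_point (hθ f) (hθ' f) ι.hom hι
    have hu' : (Over.homMk u (by
        change u ≫ v₀ ≫ T.hom = _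
        rw [reassoc_of% hu]
        exact Over.w f.hom) : f.left ⟶ V) ≫ v = f.hom := Over.OverMorphism.ext hu
    refine ⟨_, hu', Iso.ext ?_⟩
    exact hV.hom_unique (hθ' f) (hφ₁ f _ hu') hι (hφ₂ f _ hu') h
  · intro f f' g u hu hu'
    exact hV.naturality (hθ' f') g.left (α.map g) (β.map g) (isHomLift_map_of_rep α g)
      (isHomLift_map_of_rep β g) (hθm g) (hθm' g) (hφ₁ f _ hu') (hφ₁ f' _ hu)
      (hφ₂ f _ hu') (hφ₂ f' _ hu)

/-! ### Projections and isomorphisms in products and 2-fibre products. -/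

section Based

variable {𝒮 : Type u₁} [Category.{v₁} 𝒮] {𝒳 : BasedCategory.{v₂, u₂} 𝒮}
  {𝒴 : BasedCategory.{v₃, u₃} 𝒮} {𝒵 : BasedCategory.{v₄, u₄} 𝒮}

variable (𝒳 𝒴) in
/-- The first projection of the product of two categories over `𝒮`. -/
def prodFst : BasedFunctor (prod 𝒳 𝒴) 𝒳 where
  toFunctor :=
    { obj := fun a : ProdObj 𝒳 𝒴 ↦ a.fst.1
      map := fun f ↦ ProdHom.fst f
      map_id := fun _ ↦ rfl
      map_comp := fun _ _ ↦ rfl }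
  w := by
    refine CategoryTheory.Functor.ext (fun a : ProdObj 𝒳 𝒴 ↦ a.fst.2) (fun a b f ↦ ?_)
    have := ProdHom.fst_lift f
    exact IsHomLift.fac' 𝒳.p (ProdHom.base f) (ProdHom.fst f)

variable (𝒳 𝒴) in
/-- The second projection of the product of two categories over `𝒮`. -/
def prodSnd : BasedFunctor (prod 𝒳 𝒴) 𝒴 where
  toFunctor :=
    { obj := fun a : ProdObj 𝒳 𝒴 ↦ a.snd.1
      map := fun f ↦ ProdHom.snd f
      map_id := fun _ ↦ rfl
      map_comp := fun _ _ ↦ rfl }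
  w := by
    refine CategoryTheory.Functor.ext (fun a : ProdObj 𝒳 𝒴 ↦ a.snd.2) (fun a b f ↦ ?_)
    have := ProdHom.snd_lift f
    exact IsHomLift.fac' 𝒴.p (ProdHom.base f) (ProdHom.snd f)

lemma isHomLift_id_congr {𝒞 : Type u₂} [Category.{v₂} 𝒞] (p : 𝒞 ⥤ 𝒮) {a b : 𝒞} {R R' : 𝒮} (h : R = R') {φ : a ⟶ b}
    (hφ : p.IsHomLift (𝟙 R) φ) : p.IsHomLift (𝟙 R') φ := by
  subst h
  exact hφ

lemma isHomLift_id_conj {𝒞 : Type u₂} [Category.{v₂} 𝒞] (p : 𝒞 ⥤ 𝒮) {a a' b b' : 𝒞} {R : 𝒮}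
    (α : a ≅ a') (ι : a' ≅ b') (β : b ≅ b') (hα : p.IsHomLift (𝟙 R) α.hom)
    (hι : p.IsHomLift (𝟙 R) ι.hom) (hβ : p.IsHomLift (𝟙 R) β.hom) :
    p.IsHomLift (𝟙 R) (α ≪≫ ι ≪≫ β.symm).hom := by
  rw [Iso.trans_hom, Iso.trans_hom, Iso.symm_hom]
  infer_instance

lemma comp_eq_comp_of_eq_conj {𝒞 : Type u₂} [Category.{v₂} 𝒞] {a a' b b' : 𝒞} {φ : a ≅ b}
    {α : a ≅ a'} {ι : a' ≅ b'} {β : b ≅ b'} (h : φ = α ≪≫ ι ≪≫ β.symm) :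
    α.hom ≫ ι.hom = φ.hom ≫ β.hom := by
  simp [h]

lemma FiberProdHom.isIso {F : BasedFunctor 𝒳 𝒵} {G : BasedFunctor 𝒴 𝒵}
    {a b : FiberProdObj F G} (φ : a ⟶ b) (h₁ : IsIso (FiberProdHom.fst φ))
    (h₂ : IsIso (FiberProdHom.snd φ)) : IsIso φ := by
  have hl₁ := FiberProdHom.fst_lift φ
  have hl₂ := FiberProdHom.snd_lift φ
  have : IsIso (FiberProdHom.base φ) :=
    IsHomLift.isIso_of_lift_isIso 𝒳.p (FiberProdHom.base φ) (FiberProdHom.fst φ)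
  let ψ : FiberProdHom b a :=
    { base := inv (FiberProdHom.base φ)
      fst := inv (FiberProdHom.fst φ)
      snd := inv (FiberProdHom.snd φ)
      fst_lift := inferInstance
      snd_lift := inferInstance
      comm := by
        rw [Functor.map_inv, Functor.map_inv, IsIso.inv_comp_eq, ← Category.assoc,
          IsIso.eq_comp_inv, FiberProdHom.comm φ] }
  exact ⟨ψ, FiberProdHom.ext (IsIso.hom_inv_id _) (IsIso.hom_inv_id _) (IsIso.hom_inv_id _),
    FiberProdHom.ext (IsIso.inv_hom_id _) (IsIso.inv_hom_id _) (IsIso.inv_hom_id _)⟩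

end Based

variable {S : Scheme.{u}} {H : Type w} [Group H] [Finite H]
  {𝒳 : BasedCategory.{v₂, u₂} (Over S)} {𝒴 : BasedCategory.{v₃, u₃} (Over S)}
  {F : BasedFunctor 𝒳 (classifyingStack S H)} {G : BasedFunctor 𝒴 (classifyingStack S H)}
  {T V : Over S} {t : BasedFunctor (rep T) (prod 𝒳 𝒴)} {v : V ⟶ T}

/-! ### The scheme of isomorphisms as the 2-fibre product. -/

namespace IsomRepresentation

variable (r : IsomRepresentation ((t.comp (prodFst 𝒳 𝒴)).comp F) ((t.comp (prodSnd 𝒳 𝒴)).comp G) v)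

/-- The object of the 2-fibre product over `T` determined by a point of a scheme of isomorphisms. -/
def sndObj (f : Over T) (u : f.left ⟶ V) (hu : u ≫ v = f.hom) : FiberProdObj F G where
  base := ProdObj.base (t.obj f)
  fst := ProdObj.fst (t.obj f)
  snd := ProdObj.snd (t.obj f)
  iso := r.iso f u hu
  iso_lift := isHomLift_id_congr (bProj S H) (t.w_obj f).symm (φ := (r.iso f u hu).hom)
    (r.isHomLift f u hu)

/-- The action on objects of `toFiberProd`. -/
def toFiberProdObj (u : Over V) : FiberProdObj t (fiberProdToProd F G) where
  base := u.left
  fst := ⟨(Over.map v).obj u, rfl⟩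
  snd := ⟨r.sndObj ((Over.map v).obj u) u.hom rfl, t.w_obj ((Over.map v).obj u)⟩
  iso := Iso.refl (t.obj ((Over.map v).obj u))
  iso_lift := IsHomLift.id (t.w_obj ((Over.map v).obj u))

/-- A morphism over `T` compatible with the points of the scheme of isomorphisms. -/
def sndMap {f f' : Over T} (g : f ⟶ f') (u : f'.left ⟶ V) (hu : u ≫ v = f'.hom)
    (u' : f.left ⟶ V) (hu' : u' ≫ v = f.hom) (h : g.left ≫ u = u') :
    r.sndObj f u' hu' ⟶ r.sndObj f' u hu :=
  FiberProdHom.mk (ProdHom.base (t.map g)) (ProdHom.fst (t.map g)) (ProdHom.snd (t.map g))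
    (ProdHom.fst_lift (t.map g)) (ProdHom.snd_lift (t.map g)) (by
      subst h
      exact r.naturality g u hu hu')

/-- The action on morphisms of `toFiberProd`. -/
def toFiberProdMap {u u' : Over V} (g : u ⟶ u') : r.toFiberProdObj u ⟶ r.toFiberProdObj u' :=
  FiberProdHom.mk g.left ((Over.map v).map g)
    (r.sndMap ((Over.map v).map g) u'.hom rfl u.hom rfl (Over.w g))
    (CategoryTheory.IsHomLift.map (Over.forget T) ((Over.map v).map g)) (by
      have : (Over.forget T).IsHomLift g.left ((Over.map v).map g) :=
        CategoryTheory.IsHomLift.map (Over.forget T) ((Over.map v).map g)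
      have : (prodProj 𝒳 𝒴).IsHomLift g.left ((fiberProdToProd F G).map
          (r.sndMap ((Over.map v).map g) u'.hom rfl u.hom rfl (Over.w g))) :=
        BasedFunctor.preserves_isHomLift t g.left ((Over.map v).map g)
      exact @BasedFunctor.isHomLift_map _ _ _ _ (fiberProdToProd F G) _ _ _ _ _ _ this)
    ((Category.comp_id _).trans (Category.id_comp _).symm)

/-- The morphism from a scheme of isomorphisms to the 2-fibre product. -/
def toFiberProd : BasedFunctor (rep V) (fiberProd t (fiberProdToProd F G)) where
  toFunctor :=
    { obj := r.toFiberProdObj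
      map := r.toFiberProdMap
      map_id := fun u ↦ by
        have h : t.map ((Over.map v).map (𝟙 u)) = 𝟙 _ := by simp
        exact FiberProdHom.ext rfl ((Over.map v).map_id u) (FiberProdHom.ext congr(ProdHom.base $h)
          congr(ProdHom.fst $h) congr(ProdHom.snd $h))
      map_comp := fun g g' ↦ by
        have h : t.map ((Over.map v).map (g ≫ g')) =
          t.map ((Over.map v).map g) ≫ t.map ((Over.map v).map g') := by simp
        exact FiberProdHom.ext rfl ((Over.map v).map_comp g g') (FiberProdHom.ext
          congr(ProdHom.base $h) congr(ProdHom.fst $h) congr(ProdHom.snd $h)) }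
  w := rfl

lemma toFiberProd_comp_fiberProdFst :
    r.toFiberProd.comp (fiberProdFst t (fiberProdToProd F G)) = repMap v :=
  rfl

lemma faithful_toFiberProd : r.toFiberProd.Faithful where
  map_injective h := Over.OverMorphism.ext congr(FiberProdHom.base $h)

/-- The comparison isomorphisms in `toFiberProdObj` are identities, so the second component of `m`
is determined by applying `t` to the first. Its compatibility condition then identifies the
isomorphisms attached to two points of `V`, and injectivity makes the base morphism one over `V`. -/
lemma full_toFiberProd : r.toFiberProd.Full where
  map_surjective {u u'} m := by
    have hl : FiberProdHom.base m = (FiberProdHom.fst m).left :=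
      @IsHomLift.eq_of_isHomLift _ _ _ _ (Over.forget T) _ _ _ _ (FiberProdHom.fst_lift m)
    have hc : t.map (FiberProdHom.fst m) = (fiberProdToProd F G).map (FiberProdHom.snd m) :=
      (Category.comp_id _).symm.trans ((FiberProdHom.comm m).trans (Category.id_comp _))
    have hw : ((FiberProdHom.fst m).left ≫ u'.hom) ≫ v = u.hom ≫ v :=
      (Category.assoc _ _ _).trans (Over.w (FiberProdHom.fst m))
    have hcomm := FiberProdHom.comm (FiberProdHom.snd m)
    have h₁ : FiberProdHom.fst (FiberProdHom.snd m) = ProdHom.fst (t.map (FiberProdHom.fst m)) :=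
      congr(ProdHom.fst $hc).symm
    have h₂ : FiberProdHom.snd (FiberProdHom.snd m) = ProdHom.snd (t.map (FiberProdHom.fst m)) :=
      congr(ProdHom.snd $hc).symm
    rw [h₁, h₂] at hcomm
    have hn := (r.naturality (FiberProdHom.fst m) u'.hom rfl hw).symm.trans hcomm
    -- The common factor after the two isomorphisms is cancelled because morphisms of `BH` are
    -- cartesian.
    have hi := r.injective ((Over.map v).obj u) _ hw u.hom rfl (Iso.ext
      (@BObj.hom_ext_of_comp _ _ _ _ _ _ _ _ _ (𝟙 u.left) _ _
        (r.isHomLift ((Over.map v).obj u) _ hw) (r.isHomLift ((Over.map v).obj u) _ rfl) _ hn))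
    refine ⟨Over.homMk (FiberProdHom.base m) (by rw [hl]; exact hi), ?_⟩
    have hf : (Over.map v).map (Over.homMk (FiberProdHom.base m) (by rw [hl]; exact hi)) =
      FiberProdHom.fst m := Over.OverMorphism.ext hl
    refine FiberProdHom.ext rfl hf ?_
    have hs := congr(t.map $hf).trans hc
    exact FiberProdHom.ext congr(ProdHom.base $hs) congr(ProdHom.fst $hs) congr(ProdHom.snd $hs)

/-- Conjugating `ι` by the images of `j` gives an isomorphism of the two torsors at `f`, hence a
point of `V`; then `j` itself supplies the isomorphism with the given object. -/
lemma essSurj_toFiberProd : r.toFiberProd.EssSurj where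
  mem_essImage X := by
    obtain ⟨b, ⟨f, hf⟩, ⟨⟨b', x, y, ι, hι⟩, hb'⟩, j, hj⟩ := X
    change f.left = b at hf
    change b' = b at hb'
    subst hf hb'
    obtain ⟨W, f, rfl⟩ := Over.mk_surjective (f : Over T)
    have hx : 𝒳.p.IsHomLift (𝟙 W) ((prodFst 𝒳 𝒴).map j.hom) :=
      @BasedFunctor.preserves_isHomLift _ _ _ _ (prodFst 𝒳 𝒴) _ _ _ _ _ _ hj
    have hy : 𝒴.p.IsHomLift (𝟙 W) ((prodSnd 𝒳 𝒴).map j.hom) :=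
      @BasedFunctor.preserves_isHomLift _ _ _ _ (prodSnd 𝒳 𝒴) _ _ _ _ _ _ hj
    let jx := (prodFst 𝒳 𝒴).toFunctor.mapIso j
    let jy := (prodSnd 𝒳 𝒴).toFunctor.mapIso j
    have hFx : (bProj S H).IsHomLift (𝟙 W) (F.toFunctor.mapIso jx).hom :=
      @BasedFunctor.preserves_isHomLift _ _ _ _ F _ _ _ _ _ _ hx
    have hGy : (bProj S H).IsHomLift (𝟙 W) (G.toFunctor.mapIso jy).hom :=
      @BasedFunctor.preserves_isHomLift _ _ _ _ G _ _ _ _ _ _ hy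
    obtain ⟨u, hu, h⟩ := r.surjective (Over.mk f)
      (F.toFunctor.mapIso jx ≪≫ ι ≪≫ (G.toFunctor.mapIso jy).symm)
      (isHomLift_id_conj (bProj S H) _ ι _ hFx hι hGy)
    change W ⟶ V at u
    change u ≫ v = f at hu
    subst hu
    let a : r.sndObj (Over.mk (u ≫ v)) u rfl ⟶ (⟨_, x, y, ι, hι⟩ : FiberProdObj F G) :=
      FiberProdHom.mk (ProdHom.base j.hom) (ProdHom.fst j.hom) (ProdHom.snd j.hom)
        (ProdHom.fst_lift j.hom) (ProdHom.snd_lift j.hom)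
        (comp_eq_comp_of_eq_conj h)
    have ha : IsIso a := FiberProdHom.isIso a jx.isIso_hom jy.isIso_hom
    let e : r.toFiberProdObj (Over.mk u) ⟶ (⟨_, ⟨Over.mk (u ≫ v), rfl⟩, ⟨⟨_, x, y, ι, hι⟩, rfl⟩, j,
        hj⟩ : FiberProdObj t (fiberProdToProd F G)) :=
      FiberProdHom.mk (𝟙 W) (𝟙 (Over.mk (u ≫ v))) a (IsHomLift.id (p := Over.forget T) rfl)
        (@BasedFunctor.isHomLift_map _ _ _ _ (fiberProdToProd F G) _ _ _ _ _ _ hj)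
        (congr($(t.map_id (Over.mk (u ≫ v))) ≫ j.hom))
    have he : IsIso e := FiberProdHom.isIso e (inferInstanceAs (IsIso (𝟙 (Over.mk (u ≫ v))))) ha
    exact ⟨Over.mk u, ⟨@asIso _ _ _ _ e he⟩⟩

lemma isEquivalence_toFiberProd : r.toFiberProd.IsEquivalence where
  faithful := r.faithful_toFiberProd
  full := r.full_toFiberProd
  essSurj := r.essSurj_toFiberProd

end IsomRepresentation

variable (F G) in
/-- The canonical morphism `𝒳 ×_BH 𝒴 ⟶ 𝒳 × 𝒴` is representable by finite étale surjective
morphisms of schemes of constant degree `|H|`. -/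
theorem representableWith_fiberProdToProd (p : MorphismProperty Scheme.{u})
    (hp : ∀ {V T : Scheme.{u}} (v : V ⟶ T), Surjective v → IsFinite v → Etale v →
      (∀ t, v.finrank t = Nat.card H) → p v) :
    RepresentableWith p (fiberProdToProd F G) := by
  intro T t
  obtain ⟨V, v, ⟨r⟩, h₁, h₂, h₃, h₄⟩ := exists_isomRepresentation
    ((t.comp (prodFst 𝒳 𝒴)).comp F) ((t.comp (prodSnd 𝒳 𝒴)).comp G)
  exact ⟨V, v, r.toFiberProd, r.isEquivalence_toFiberProd, r.toFiberProd_comp_fiberProdFst,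
    hp v.left h₁ h₂ h₃ h₄⟩

end StackTheory

theorem mainTheorem7 (H : Type w) [CommGroup H] [Finite H]
    (𝔛 : BasedCategory.{v₂, u₂} (Over (Spec (.of ℂ))))
    (𝔜 : BasedCategory.{v₃, u₃} (Over (Spec (.of ℂ))))
    (h𝔛 : StackTheory.IsDeligneMumford 𝔛) (h𝔜 : StackTheory.IsDeligneMumford 𝔜)
    (F : BasedFunctor 𝔛 (StackTheory.classifyingStack (Spec (.of ℂ)) H))
    (G : BasedFunctor 𝔜 (StackTheory.classifyingStack (Spec (.of ℂ)) H)) :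
    StackTheory.IsSurjectiveMor (StackTheory.fiberProdToProd F G) ∧
      StackTheory.IsFiniteMor (StackTheory.fiberProdToProd F G) ∧
      StackTheory.IsEtaleMor (StackTheory.fiberProdToProd F G) ∧
      StackTheory.HasDegree (StackTheory.fiberProdToProd F G) (Nat.card H) := by
  -- The four claims select different properties of the same representing scheme; flatness in the
  -- last one follows from étaleness.
  refine ⟨StackTheory.representableWith_fiberProdToProd F G _ fun _ h _ _ _ ↦ h,
    StackTheory.representableWith_fiberProdToProd F G _ fun _ _ h _ _ ↦ h,
    StackTheory.representableWith_fiberProdToProd F G _ fun _ _ _ h _ ↦ h,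
    StackTheory.representableWith_fiberProdToProd F G _ fun _ _ h h' h'' ↦
      ⟨h, inferInstance, h''⟩⟩
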